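/- Types are read as topological spaces: identity types as path spaces, pullbacks as homotopy pullbacks, groupoids ($1$-types) as spaces $X$ with $\pi_n(X,x)=0$ for all $n\ge 2$ and all $x\in X$, and equivalences as weak homotopy equivalences. Let $m\ge 1$ be an integer, $\mathbb Z_m=\mathbb Z/m\mathbb Z$. Let $B\mathbb Z_m$ be any delooping of $\mathbb Z_m$, i.e. a pointed path-connected groupoid $(B,b)$ with an isomorphism of groups $e:\pi_1(B,b)\cong\mathbb Z_m$. Let $S^1\subset\mathbb C$ be the circle, pointed at $1$, and let $\ell\in\pi_1(S^1,1)$ be the class of $t\mapsto e^{2\pi i t}$, whose powers identify $\mathbb Z$ with the loop group of $S^1$. Let $B\phi:S^1\to B$ be a delooping of the quotient morphism $\phi:\mathbb Z\to\mathbb Z_m$, i.e. a continuous map with a path from $B\phi(1)$ to $b$ such that the induced map on loops $(B\phi)_*:\pi_1(S^1,1)\to\pi_1(B,b)$ satisfies $e((B\phi)_*(\ell^k))=k \bmod m$ for all $k\in\mathbb Z$. Let $$R=S^1\times_{B\mathbb Z_m}S^1=\{(x,y,\gamma)\mid x,y\in S^1,\ \gamma\text{ a path in }B\text{ from }B\phi(x)\text{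 to }B\phi(y)\}$$ be the homotopy pullback of $B\phi$ with itself, pointed at $*=(1,1,\mathrm{refl})$. Then: 1. $R$ is a pointed connected groupoid: it is path connected and $\pi_n(R,r)=0$ for all $n\ge2$ and all $r\in R$. 2. Its loop group is the pullback $\mathbb Z\times_{\mathbb Z_m}\mathbb Z=\{(j,k)\in\mathbb Z^2\mid j\equiv k \bmod m\}$: there is an isomorphism of groups $\Phi:\pi_1(R,*)\cong\mathbb Z\times_{\mathbb Z_m}\mathbb Z$ such that, if $\Phi(\gamma)=(j,k)$, then the two projections $R\to S^1$ send $\gamma$ to $\ell^j$ and $\ell^k$ respectively. 3. The group $\mathbb Z\times_{\mathbb Z_m}\mathbb Z$ is isomorphic to $\mathbb Z^2$. 4. $R$ is equivalent to the torus: there is a weak homotopy equivalence $S^1\times S^1\to R$ sending $(1,1)$ to $*$. -/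

import Mathlib

/-! Types are read as topological spaces: identity types are path spaces, pullbacks are homotopy
pullbacks, groupoids are spaces without homotopy in degrees at least two, and equivalences are weak
homotopy equivalences. -/

noncomputable section

/-- The map induced by a continuous map on `n`-dimensional loops. -/
def genLoopMap {X Y : Type*} [TopologicalSpace X] [TopologicalSpace Y] (f : C(X, Y)) (n : ℕ)
    (x : X) (γ : GenLoop (Fin n) X x) : GenLoop (Fin n) Y (f x) :=
  ⟨f.comp γ.1, fun t ht => congrArg f (γ.2 t ht)⟩

/-- The map `π_n(X, x) → π_n(Y, f x)` induced by a continuous map. -/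
def homotopyGroupMap {X Y : Type*} [TopologicalSpace X] [TopologicalSpace Y] (f : C(X, Y)) (n : ℕ)
    (x : X) : HomotopyGroup.Pi n X x → HomotopyGroup.Pi n Y (f x) :=
  Quotient.map (genLoopMap f n x) fun _ _ h =>
    ContinuousMap.HomotopicRel.comp_continuousMap h f

/-- Weak homotopy equivalences: bijective on path components, and on all homotopy groups at all
base points. -/
structure IsWeakHomotopyEquiv {X Y : Type*} [TopologicalSpace X] [TopologicalSpace Y]
    (f : C(X, Y)) : Prop where
  surjective_pi_zero : ∀ y : Y, ∃ x : X, Joined (f x) y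
  injective_pi_zero : ∀ x x' : X, Joined (f x) (f x') → Joined x x'
  bijective_pi : ∀ n : ℕ, 1 ≤ n → ∀ x : X, Function.Bijective (homotopyGroupMap f n x)

/-- A space is a (homotopy) groupoid, that is, a `1`-type, if all its homotopy groups in degrees at
least two vanish, at all base points. -/
def IsHomotopyGroupoid (X : Type*) [TopologicalSpace X] : Prop :=
  ∀ n : ℕ, 2 ≤ n → ∀ x : X, Subsingleton (HomotopyGroup.Pi n X x)

/-- A delooping of the group `G` on the space `B`: a base point, such that `B` is path connected and
its loop space is identified with the (discrete) group `G`. -/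
structure Delooping (G : Type*) [Group G] (B : Type*) [TopologicalSpace B] where
  pt : B
  pathConnected : PathConnectedSpace B
  groupoid : IsHomotopyGroupoid B
  loopEquiv : FundamentalGroup B pt ≃* G

/-- Pointed maps, where the base point is preserved up to a specified path. -/
structure PointedMap (X : Type*) [TopologicalSpace X] (x : X) (Y : Type*) [TopologicalSpace Y]
    (y : Y) where
  toMap : C(X, Y)
  ptPath : Path (toMap x) y

/-- The action of a pointed map on loops, `[γ] ↦ [pt⁻¹ · f(γ) · pt]`. -/
def PointedMap.loopMap {X : Type*} [TopologicalSpace X] {x : X} {Y : Type*} [TopologicalSpace Y]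
    {y : Y} (f : PointedMap X x Y y) : FundamentalGroup X x →* FundamentalGroup Y y :=
  (FundamentalGroup.fundamentalGroupMulEquivOfPath f.ptPath).toMonoidHom.comp
    (FundamentalGroup.map f.toMap x)

/-- The standard loop of the circle, `t ↦ exp(2πit)`. -/
def circleLoop : Path (1 : Circle) 1 where
  toFun t := Circle.exp (2 * Real.pi * (t : ℝ))
  continuous_toFun := by fun_prop
  source' := by simp
  target' := by simp

/-- The class of the standard loop in the fundamental group of the circle; its powers give the usual
identification of `ℤ` with the loop group of the circle. -/
def circleGenerator : FundamentalGroup Circle 1 :=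
  FundamentalGroup.fromPath (Path.Homotopic.Quotient.mk circleLoop)

/-- `f` deloops the quotient morphism `ℤ → ℤ/m`: on loops, it sends the `k`-th power of the standard
loop of the circle to `k mod m`. -/
def IsDeloopingOfQuotient {m : ℕ} {B : Type*} [TopologicalSpace B]
    (D : Delooping (Multiplicative (ZMod m)) B) (f : PointedMap Circle 1 B D.pt) : Prop :=
  ∀ k : ℤ, D.loopEquiv (f.loopMap (circleGenerator ^ k)) = Multiplicative.ofAdd (k : ZMod m)

/-- The homotopy pullback: triples of `x : X`, `y : Y` and a path from `f x` to `g y`. -/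
abbrev HomotopyPullback {X Y Z : Type*} [TopologicalSpace X] [TopologicalSpace Y]
    [TopologicalSpace Z] (f : C(X, Z)) (g : C(Y, Z)) : Type _ :=
  {p : X × Y × C(unitInterval, Z) // p.2.2 0 = f p.1 ∧ p.2.2 1 = g p.2.1}

namespace HomotopyPullback

variable {X Y Z : Type*} [TopologicalSpace X] [TopologicalSpace Y] [TopologicalSpace Z]

/-- The first projection. -/
def fst (f : C(X, Z)) (g : C(Y, Z)) : C(HomotopyPullback f g, X) :=
  ⟨fun p => p.1.1, by fun_prop⟩

/-- The second projection. -/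
def snd (f : C(X, Z)) (g : C(Y, Z)) : C(HomotopyPullback f g, Y) :=
  ⟨fun p => p.1.2.1, by fun_prop⟩

/-- The diagonal point `(x, x, refl)` of the homotopy pullback of `f` with itself. -/
def diag (f : C(X, Z)) (x : X) : HomotopyPullback f f :=
  ⟨(x, x, ContinuousMap.const _ (f x)), rfl, rfl⟩

end HomotopyPullback

/-- The pullback `ℤ ×_{ℤ/m} ℤ` of the quotient morphism with itself, as a subgroup of `ℤ × ℤ`. -/
def cyclicPullback (m : ℕ) : AddSubgroup (ℤ × ℤ) where
  carrier := {p | (p.1 : ZMod m) = (p.2 : ZMod m)}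
  zero_mem' := by simp
  add_mem' := by
    intro a b ha hb
    simp only [Set.mem_ofPred_eq, Prod.fst_add, Prod.snd_add, Int.cast_add] at *
    rw [ha, hb]
  neg_mem' := by
    intro a ha
    simp only [Set.mem_ofPred_eq, Prod.fst_neg, Prod.snd_neg, Int.cast_neg] at *
    rw [ha]

end

noncomputable section

open scoped unitInterval Topology

/-! A map from a cube to the homotopy pullback `R` consists of two circle-valued maps, which lift to
the line, and a family of paths in `B`. Two such maps that agree on the boundary, with lifts that
agree there, are homotopic rel boundary: interpolate the lifts linearly, and the path coordinate
becomes the problem of extending a map into `B` from the boundary of a cube of dimension `n + 2`.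
This is solvable because `π_{n+1}(B)` vanishes for `n ≥ 1` (`IsHomotopyGroupoid.exists_prism`,
`pullback_homotopicRel`).

For `n ≥ 2` the lifts are constant on the connected boundary, so `π_n(R) = 0`. For `n = 1` a loop is
determined by its two winding numbers `(j, k)`. A loop at the diagonal point is a homotopy in `B`
between the images of `ℓ^j` and `ℓ^k`, so the pairs that occur are those with `j ≡ k mod m`. Path
connectedness holds because `ℤ → ℤ/m` is surjective (`joined_diag`).

The torus maps to `R` over `(u, v) ↦ (u, u vᵐ)`; the path coordinate is one more cube filling,
started from a nullhomotopy of the image of `ℓ^m` (`exists_torus_to_pullback`). On winding numbers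
the map is `(j, k) ↦ (j, j + mk)`, an isomorphism onto the lattice above. -/

/-! ### Extending maps into a groupoid from spheres and cube boundaries -/

/-- The centred coordinates `2p - 1` of a point of the unit cube. -/
def cubeCentre {n : ℕ} (p : Fin n → I) : Fin n → ℝ := fun i => 2 * (p i : ℝ) - 1

@[fun_prop]
lemma continuous_cubeCentre {n : ℕ} : Continuous (cubeCentre (n := n)) := by
  unfold cubeCentre; fun_prop

lemma abs_two_mul_sub_one_le (t : I) : |2 * (t : ℝ) - 1| ≤ 1 := by
  rw [abs_le]; constructor <;> linarith [t.2.1, t.2.2]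

lemma abs_two_mul_sub_one_lt {t : I} (h0 : t ≠ 0) (h1 : t ≠ 1) : |2 * (t : ℝ) - 1| < 1 := by
  rw [abs_lt]
  constructor <;> linarith [unitInterval.pos_iff_ne_zero.2 h0, unitInterval.lt_one_iff_ne_one.2 h1,
    show (0 : ℝ) < t from unitInterval.pos_iff_ne_zero.2 h0,
    show (t : ℝ) < 1 from unitInterval.lt_one_iff_ne_one.2 h1]

lemma norm_cubeCentre_le {n : ℕ} (p : Fin n → I) : ‖cubeCentre p‖ ≤ 1 :=
  (pi_norm_le_iff_of_nonneg zero_le_one).2 fun i => abs_two_mul_sub_one_le (p i)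

lemma norm_cubeCentre_eq_one_iff {n : ℕ} (p : Fin n → I) :
    ‖cubeCentre p‖ = 1 ↔ p ∈ Cube.boundary (Fin n) := by
  constructor
  · intro h
    by_contra hp
    refine h.not_lt ((pi_norm_lt_iff zero_lt_one).2 fun i => ?_)
    exact abs_two_mul_sub_one_lt (fun h0 => hp ⟨i, Or.inl h0⟩) (fun h1 => hp ⟨i, Or.inr h1⟩)
  · rintro ⟨i, hi⟩
    refine le_antisymm (norm_cubeCentre_le p) ?_
    refine le_trans ?_ (norm_le_pi_norm (cubeCentre p) i)
    rcases hi with hi | hi <;> simp [cubeCentre, hi]; norm_num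

lemma cubeCentre_injective {n : ℕ} : Function.Injective (cubeCentre (n := n)) := by
  intro p q h
  ext i
  have := congrFun h i
  simp only [cubeCentre] at this
  linarith

lemma exists_cubeCentre_eq {n : ℕ} (v : Fin n → ℝ) (hv : ‖v‖ ≤ 1) :
    ∃ p : Fin n → I, cubeCentre p = v := by
  have h : ∀ i, |v i| ≤ 1 := fun i => (norm_le_pi_norm v i).trans hv
  refine ⟨fun i => ⟨(v i + 1) / 2, ?_, ?_⟩, ?_⟩
  · linarith [(abs_le.1 (h i)).1]
  · linarith [(abs_le.1 (h i)).2]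
  · ext i; simp only [cubeCentre]; ring

/-- A map from the cube to `ℝⁿ × ℝ`, collapsing the boundary to a point, whose directions cover the
unit sphere, injectively off the boundary. -/
def cubeRay {n : ℕ} (p : Fin n → I) : (Fin n → ℝ) × ℝ :=
  ((1 - ‖cubeCentre p‖) • cubeCentre p, 1 - 2 * ‖cubeCentre p‖)

@[fun_prop]
lemma continuous_cubeRay {n : ℕ} : Continuous (cubeRay (n := n)) := by
  unfold cubeRay; fun_prop

lemma cubeRay_of_mem_boundary {n : ℕ} {p : Fin n → I} (hp : p ∈ Cube.boundary (Fin n)) :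
    cubeRay p = (0, -1) := by
  rw [← norm_cubeCentre_eq_one_iff] at hp
  simp only [cubeRay, hp]
  norm_num

lemma norm_fst_cubeRay {n : ℕ} (p : Fin n → I) :
    ‖(cubeRay p).1‖ = (1 - ‖cubeCentre p‖) * ‖cubeCentre p‖ := by
  rw [cubeRay, norm_smul, Real.norm_of_nonneg (by linarith [norm_cubeCentre_le p])]

lemma cubeRay_ne_zero {n : ℕ} (p : Fin n → I) : cubeRay p ≠ 0 := by
  intro h
  have h1 := norm_fst_cubeRay p
  have h2 : (cubeRay p).2 = 1 - 2 * ‖cubeCentre p‖ := rfl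
  rw [h] at h1 h2
  simp only [Prod.fst_zero, norm_zero, Prod.snd_zero] at h1 h2
  nlinarith

/-- Every value `(y, t)` of `cubeRay` satisfies `t ^ 2 + 4‖y‖ = 1`, and an open ray from the origin
meets this set only once, so `c = 1`. The last coordinate then gives the radius, and the first gives
the point unless the radius is `1`. -/
lemma cubeRay_eq_smul {n : ℕ} {p q : Fin n → I} {c : ℝ} (hc : 0 < c)
    (h : cubeRay p = c • cubeRay q) :
    p = q ∨ p ∈ Cube.boundary (Fin n) ∧ q ∈ Cube.boundary (Fin n) := by
  have h1 : (1 - ‖cubeCentre p‖) * ‖cubeCentre p‖ =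
      c * ((1 - ‖cubeCentre q‖) * ‖cubeCentre q‖) := by
    rw [← norm_fst_cubeRay, ← norm_fst_cubeRay, h, Prod.smul_fst, norm_smul,
      Real.norm_of_nonneg hc.le]
  have h2 : 1 - 2 * ‖cubeCentre p‖ = c * (1 - 2 * ‖cubeCentre q‖) := congrArg Prod.snd h
  have hx : (1 - ‖cubeCentre p‖) • cubeCentre p = c • (1 - ‖cubeCentre q‖) • cubeCentre q :=
    congrArg Prod.fst h
  have hq := norm_cubeCentre_le q
  have hq0 := norm_nonneg (cubeCentre q)
  set r := ‖cubeCentre p‖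
  set s := ‖cubeCentre q‖
  have hc1 : c = 1 := by
    have e : (c - 1) * (c * (1 - 2 * s) ^ 2 + 1) = 0 := by
      have e1 : (1 - 2 * r) ^ 2 + 4 * ((1 - r) * r) = 1 := by ring
      rw [h1, h2] at e1
      linear_combination e1
    have : c * (1 - 2 * s) ^ 2 + 1 ≠ 0 := by positivity
    linarith [(mul_eq_zero.1 e).resolve_right this]
  subst hc1
  have hrs : r = s := by linarith
  rw [hrs, one_smul] at hx
  by_cases hs : s = 1
  · exact Or.inr ⟨(norm_cubeCentre_eq_one_iff p).1 (hrs.trans hs),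
      (norm_cubeCentre_eq_one_iff q).1 hs⟩
  · exact Or.inl (cubeCentre_injective (smul_right_injective _ (sub_ne_zero.2 (Ne.symm hs)) hx))

lemma exists_smul_cubeRay {n : ℕ} (hn : 1 ≤ n) (z : (Fin n → ℝ) × ℝ) (hz : z ≠ 0) :
    ∃ (p : Fin n → I) (c : ℝ), 0 < c ∧ z = c • cubeRay p := by
  obtain ⟨y, t⟩ := z
  by_cases hy : y = 0
  · subst hy
    rcases lt_trichotomy t 0 with ht | ht | ht
    -- The downward direction is hit only by the boundary of the cube, which is nonempty because `n
    -- ≥ 1`.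
    · refine ⟨fun _ => 0, -t, by linarith, ?_⟩
      rw [cubeRay_of_mem_boundary ⟨⟨0, hn⟩, Or.inl rfl⟩]
      simp
    · exact absurd (by rw [ht]; rfl) hz
    · obtain ⟨p, hp⟩ := exists_cubeCentre_eq (0 : Fin n → ℝ) (by simp)
      exact ⟨p, t, ht, by simp [cubeRay, hp]⟩
  · have hy0 : 0 < ‖y‖ := norm_pos_iff.2 hy
    set η := ‖y‖ with hη
    have hsq := Real.sq_sqrt (show 0 ≤ 4 * η ^ 2 + t ^ 2 by positivity)
    have hpos : 0 < √(4 * η ^ 2 + t ^ 2) := Real.sqrt_pos.2 (by positivity)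
    -- The scale `μ` is the positive root of `(t/μ)² + 4η/μ = 1`, the relation satisfied by values
    -- of `cubeRay`; the radius must then be `(1 - t/μ)/2`.
    set μ := 2 * η + √(4 * η ^ 2 + t ^ 2) with hμ
    have hμ0 : 0 < μ := by positivity
    have hμ2 : μ ^ 2 - 4 * η * μ - t ^ 2 = 0 := by
      rw [hμ]; linear_combination hsq
    have htμ : |t| < μ := abs_lt_of_sq_lt_sq (by nlinarith [mul_pos hy0 hμ0]) hμ0.le
    have ht1 := (abs_lt.1 htμ).1
    have ht2 := (abs_lt.1 htμ).2
    have hd : 0 < μ + t := by linarith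
    have hnorm : ‖(2 / (μ + t)) • y‖ = (1 - t / μ) / 2 := by
      rw [norm_smul, Real.norm_of_nonneg (by positivity), ← hη]
      field_simp
      linear_combination -hμ2
    obtain ⟨p, hp⟩ := exists_cubeCentre_eq ((2 / (μ + t)) • y) (by
      rw [hnorm]
      have : -1 < t / μ := by rw [lt_div_iff₀ hμ0]; linarith
      linarith)
    refine ⟨p, μ, hμ0, ?_⟩
    rw [cubeRay, hp, hnorm, Prod.smul_mk, smul_smul, smul_smul]
    ext1
    · simp only
      rw [show μ * (1 - (1 - t / μ) / 2) * (2 / (μ + t)) = 1 by field_simp; ring, one_smul]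
    · simp only [smul_eq_mul]
      field_simp
      ring

/-- The map from the cylinder on the cube onto the unit ball of `ℝⁿ × ℝ`, which is radial in the last
variable. -/
def cylinderToBall {n : ℕ} (z : I × (Fin n → I)) : Metric.closedBall (0 : (Fin n → ℝ) × ℝ) 1 :=
  ⟨((1 - (z.1 : ℝ)) * ‖cubeRay z.2‖⁻¹) • cubeRay z.2, by
    have h := norm_pos_iff.2 (cubeRay_ne_zero z.2)
    rw [mem_closedBall_zero_iff, norm_smul, norm_mul, norm_inv, norm_norm, mul_assoc,
      inv_mul_cancel₀ h.ne', mul_one, Real.norm_of_nonneg (by linarith [z.1.2.2])]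
    linarith [z.1.2.1]⟩

lemma continuous_cylinderToBall {n : ℕ} : Continuous (cylinderToBall (n := n)) := by
  have h1 : Continuous fun z : I × (Fin n → I) => cubeRay z.2 := by fun_prop
  have h2 : Continuous fun z : I × (Fin n → I) => ‖cubeRay z.2‖⁻¹ :=
    h1.norm.inv₀ fun z => norm_ne_zero_iff.2 (cubeRay_ne_zero z.2)
  have h3 : Continuous fun z : I × (Fin n → I) => 1 - (z.1 : ℝ) := by fun_prop
  exact ((h3.mul h2).smul h1).subtype_mk _

lemma norm_cylinderToBall {n : ℕ} (z : I × (Fin n → I)) :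
    ‖(cylinderToBall z : (Fin n → ℝ) × ℝ)‖ = 1 - z.1 := by
  have h := norm_pos_iff.2 (cubeRay_ne_zero z.2)
  rw [cylinderToBall, norm_smul, norm_mul, norm_inv, norm_norm, mul_assoc,
    inv_mul_cancel₀ h.ne', mul_one, Real.norm_of_nonneg (by linarith [z.1.2.2])]

lemma cylinderToBall_surjective {n : ℕ} (hn : 1 ≤ n) :
    Function.Surjective (cylinderToBall (n := n)) := by
  rintro ⟨z, hz⟩
  rw [mem_closedBall_zero_iff] at hz
  by_cases h0 : z = 0
  · subst h0
    exact ⟨(1, fun _ => 0), Subtype.ext (by simp [cylinderToBall])⟩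
  obtain ⟨p, c, hc, rfl⟩ := exists_smul_cubeRay hn z h0
  refine ⟨(⟨1 - ‖c • cubeRay p‖, by linarith, by linarith [norm_nonneg (c • cubeRay p)]⟩, p),
    Subtype.ext ?_⟩
  have h := norm_pos_iff.2 (cubeRay_ne_zero p)
  simp only [cylinderToBall, sub_sub_cancel]
  rw [norm_smul, Real.norm_of_nonneg hc.le, mul_assoc, mul_inv_cancel₀ h.ne', mul_one]

/-- The norm recovers the time. The only collapsing is of the end at time `1` to the centre, and of
the boundary of the cube to a point at each time: what a nullhomotopy rel boundary collapses as
well. -/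
lemma cylinderToBall_eq {n : ℕ} {z w : I × (Fin n → I)} (h : cylinderToBall z = cylinderToBall w) :
    z.1 = w.1 ∧ (z.1 = 1 ∨ z.2 = w.2 ∨
      z.2 ∈ Cube.boundary (Fin n) ∧ w.2 ∈ Cube.boundary (Fin n)) := by
  have h1 : z.1 = w.1 := by
    have := norm_cylinderToBall z
    rw [h, norm_cylinderToBall] at this
    exact Subtype.ext (by linarith)
  refine ⟨h1, ?_⟩
  by_cases hz : z.1 = 1
  · exact Or.inl hz
  right
  have hz' : 0 < 1 - (z.1 : ℝ) := by
    have : (z.1 : ℝ) < 1 := unitInterval.lt_one_iff_ne_one.2 hz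
    linarith
  have hp := norm_pos_iff.2 (cubeRay_ne_zero z.2)
  have hq := norm_pos_iff.2 (cubeRay_ne_zero w.2)
  have e : ((1 - (z.1 : ℝ)) * ‖cubeRay z.2‖⁻¹) • cubeRay z.2 =
      ((1 - (w.1 : ℝ)) * ‖cubeRay w.2‖⁻¹) • cubeRay w.2 := congrArg Subtype.val h
  rw [← h1, mul_smul, mul_smul] at e
  have e' := smul_right_injective _ hz'.ne' e
  refine cubeRay_eq_smul (c := ‖cubeRay z.2‖ * ‖cubeRay w.2‖⁻¹) (by positivity) ?_
  rw [mul_smul, ← e', smul_smul, mul_inv_cancel₀ hp.ne', one_smul]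

/-- If `π_n` vanishes at all base points, then maps from the `n`-sphere extend to the ball. -/
theorem exists_extension_closedBall {B : Type*} [TopologicalSpace B] {n : ℕ} (hn : 1 ≤ n)
    (hB : ∀ b : B, Subsingleton (HomotopyGroup.Pi n B b))
    (u : (Fin n → ℝ) × ℝ → B) (hu : ContinuousOn u (Metric.sphere 0 1)) :
    ∃ G : C(Metric.closedBall (0 : (Fin n → ℝ) × ℝ) 1, B),
      ∀ z : Metric.closedBall (0 : (Fin n → ℝ) × ℝ) 1, ‖(z : (Fin n → ℝ) × ℝ)‖ = 1 → G z = u z := by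
  let d : C(Fin n → I, (Fin n → ℝ) × ℝ) := ⟨fun p => (cylinderToBall (0, p)).1,
    continuous_subtype_val.comp (continuous_cylinderToBall.comp (by fun_prop))⟩
  have hd : ∀ p, d p ∈ Metric.sphere (0 : (Fin n → ℝ) × ℝ) 1 := fun p => by
    rw [mem_sphere_zero_iff_norm]
    exact (norm_cylinderToBall (0, p)).trans (by simp)
  let b := u (0, -1)
  let γ : GenLoop (Fin n) B b := ⟨⟨fun p => u (d p), hu.comp_continuous d.continuous hd⟩, by
    intro p hp
    refine congrArg u ?_
    change ((1 - ((0 : I) : ℝ)) * ‖cubeRay p‖⁻¹) • cubeRay p = _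
    rw [cubeRay_of_mem_boundary hp]
    simp [Prod.norm_def]⟩
  have hγ : GenLoop.Homotopic γ GenLoop.const :=
    Quotient.exact ((hB b).elim (Quotient.mk _ γ) (Quotient.mk _ GenLoop.const))
  obtain ⟨F⟩ := hγ
  have hF : ∀ s p, p ∈ Cube.boundary (Fin n) → F (s, p) = b := fun s p hp =>
    (F.eq_fst s hp).trans (γ.2 p hp)
  -- A continuous surjection from a compact space to a Hausdorff one is a quotient map, so the
  -- nullhomotopy descends to the ball.
  have hq : Topology.IsQuotientMap (cylinderToBall (n := n)) :=
    continuous_cylinderToBall.isClosedMap.isQuotientMap continuous_cylinderToBall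
      (cylinderToBall_surjective hn)
  have hcompat : ∀ z w : I × (Fin n → I), cylinderToBall z = cylinderToBall w → F z = F w := by
    rintro ⟨s, p⟩ ⟨t, q⟩ h
    obtain ⟨rfl, h⟩ : s = t ∧ _ := cylinderToBall_eq h
    rcases h with rfl | rfl | ⟨hp, hq⟩
    · exact (F.apply_one p).trans (F.apply_one q).symm
    · rfl
    · exact (hF _ _ hp).trans (hF _ _ hq).symm
  have hfac : Function.FactorsThrough F.toContinuousMap
      (⟨_, continuous_cylinderToBall⟩ : C(I × (Fin n → I), _)) := fun z w h => hcompat z w h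
  let G := hq.lift F.toContinuousMap hfac
  have hG : ∀ z, G (cylinderToBall z) = F z := fun z =>
    congrArg (fun k : C(_, B) => k z) (hq.lift_comp F.toContinuousMap hfac)
  refine ⟨G, fun z hz => ?_⟩
  obtain ⟨⟨s, p⟩, rfl⟩ := cylinderToBall_surjective hn z
  rw [norm_cylinderToBall] at hz
  obtain rfl : s = 0 := Subtype.ext (by simp only [Set.Icc.coe_zero]; linarith)
  rw [hG]
  exact F.apply_zero p

/-- The boundary of the cube `(Fin k → I) × I × I`. -/
def prismBoundary (k : ℕ) : Set ((Fin k → I) × I × I) :=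
  {z | z.1 ∈ Cube.boundary (Fin k) ∨ (z.2.1 = 0 ∨ z.2.1 = 1) ∨ (z.2.2 = 0 ∨ z.2.2 = 1)}

/-- In a groupoid, maps from the boundary of a cube of dimension at least three extend to the cube. -/
theorem IsHomotopyGroupoid.exists_extension {B : Type*} [TopologicalSpace B]
    (hB : IsHomotopyGroupoid B) {k : ℕ} (hk : 1 ≤ k) (u : (Fin k → I) × I × I → B)
    (hu : ContinuousOn u (prismBoundary k)) :
    ∃ G : C((Fin k → I) × I × I, B), ∀ z ∈ prismBoundary k, G z = u z := by
  -- In the sup norm the unit ball is a cube and the unit sphere its boundary; `r` rescales `[-1,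
  -- 1]` to `I`, clamped so as to be defined on all of `ℝ`.
  let r : ℝ → I := fun x => Set.projIcc 0 1 zero_le_one ((x + 1) / 2)
  have hr : Continuous r := continuous_projIcc.comp (by fun_prop)
  have hrI : ∀ t : I, r (2 * t - 1) = t := fun t => by
    simp only [r]
    rw [show (2 * (t : ℝ) - 1 + 1) / 2 = t by ring]
    exact Set.projIcc_val _ t
  have hr1 : ∀ x : ℝ, |x| = 1 → r x = 0 ∨ r x = 1 := fun x hx => by
    rcases eq_or_eq_neg_of_abs_eq hx with rfl | rfl
    · right; convert hrI 1 using 2; norm_num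
    · left; convert hrI 0 using 2; norm_num
  let ρ : (Fin (k + 1) → ℝ) × ℝ → (Fin k → I) × I × I :=
    fun z => (fun i => r (z.1 i.succ), r (z.1 0), r z.2)
  have hρ : Continuous ρ := by fun_prop
  have hρs : ∀ z ∈ Metric.sphere (0 : (Fin (k + 1) → ℝ) × ℝ) 1, ρ z ∈ prismBoundary k := by
    intro z hz
    rw [mem_sphere_zero_iff_norm, Prod.norm_def] at hz
    rcases max_choice ‖z.1‖ ‖z.2‖ with h | h <;> rw [h] at hz
    · obtain ⟨i, hi⟩ : ∃ i, |z.1 i| = 1 := by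
        by_contra! hne
        refine hz.not_lt ((pi_norm_lt_iff zero_lt_one).2 fun i => lt_of_le_of_ne ?_ (hne i))
        exact (norm_le_pi_norm z.1 i).trans hz.le
      rcases Fin.eq_zero_or_eq_succ i with rfl | ⟨j, rfl⟩
      · exact Or.inr (Or.inl (hr1 _ hi))
      · exact Or.inl ⟨j, hr1 _ hi⟩
    · exact Or.inr (Or.inr (hr1 _ hz))
  -- The boundary of a cube of dimension `k + 2` is a sphere of dimension `k + 1 ≥ 2`.
  obtain ⟨G, hG⟩ := exists_extension_closedBall (by omega) (hB (k + 1) (by omega)) (u ∘ ρ)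
    (hu.comp hρ.continuousOn hρs)
  let κ : (Fin k → I) × I × I → (Fin (k + 1) → ℝ) × ℝ :=
    fun z => (cubeCentre (Fin.cons z.2.1 z.1), 2 * (z.2.2 : ℝ) - 1)
  have hκ : Continuous κ := by
    have : Continuous fun z : (Fin k → I) × I × I => (Fin.cons z.2.1 z.1 : Fin (k + 1) → I) :=
      Continuous.finCons (by fun_prop) (by fun_prop)
    fun_prop
  have hκ1 : ∀ z, ‖κ z‖ ≤ 1 := fun z =>
    max_le (norm_cubeCentre_le _) (abs_two_mul_sub_one_le _)
  refine ⟨⟨fun z => G ⟨κ z, by simpa using hκ1 z⟩, by fun_prop⟩, fun z hz => ?_⟩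
  have hρκ : ρ (κ z) = z := by
    simp only [ρ, κ, cubeCentre, Fin.cons_succ, Fin.cons_zero, hrI]
  refine (hG ⟨κ z, _⟩ ?_).trans (congrArg u hρκ)
  refine le_antisymm (hκ1 z) ?_
  have hface : ∀ t : I, t = 0 ∨ t = 1 → |2 * (t : ℝ) - 1| = 1 := by
    rintro t (rfl | rfl) <;> norm_num
  rcases hz with ⟨i, hi⟩ | h | h
  · refine le_trans ?_ (le_max_left _ _)
    refine le_trans (hface _ hi).ge ?_
    simpa [κ, cubeCentre] using norm_le_pi_norm (κ z).1 i.succ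
  · refine le_trans ?_ (le_max_left _ _)
    refine le_trans (hface _ h).ge ?_
    simpa [κ, cubeCentre] using norm_le_pi_norm (κ z).1 0
  · exact le_trans (hface _ h).ge (le_max_right _ _)

/-! ### The universal cover of the circle and winding numbers -/

/-- The universal covering `t ↦ exp(2πit)` of the circle. -/
def circleCover : C(ℝ, Circle) := ⟨fun t => Circle.exp (2 * Real.pi * t), by fun_prop⟩

lemma circleCover_add (s t : ℝ) : circleCover (s + t) = circleCover s * circleCover t := by
  simp [circleCover, mul_add, Circle.exp_add]

@[simp]
lemma circleCover_zero : circleCover 0 = 1 := by simp [circleCover]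

lemma circleCover_eq_iff {s t : ℝ} : circleCover s = circleCover t ↔ ∃ n : ℤ, s = t + n := by
  have hpi := Real.pi_pos.ne'
  simp only [circleCover, ContinuousMap.coe_mk, Circle.exp_eq_exp]
  refine exists_congr fun n => ⟨fun h => ?_, fun h => by rw [h]; ring⟩
  have : 2 * Real.pi * (s - (t + n)) = 0 := by linear_combination h
  have := (mul_eq_zero.1 this).resolve_left (by positivity)
  linarith

@[simp]
lemma circleCover_intCast (n : ℤ) : circleCover n = 1 := by
  rw [← circleCover_zero, circleCover_eq_iff]
  exact ⟨n, by simp⟩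

lemma circleCover_intCast_mul (n : ℤ) (t : ℝ) : circleCover (n * t) = circleCover t ^ n := by
  simp only [circleCover, ContinuousMap.coe_mk]
  rw [← Circle.exp_zsmul]
  congr 1
  rw [zsmul_eq_mul]; ring

lemma circleCover_surjective : Function.Surjective circleCover := fun z => by
  obtain ⟨t, rfl⟩ := Circle.exp_surjective z
  refine ⟨t / (2 * Real.pi), ?_⟩
  have := Real.pi_pos.ne'
  simp only [circleCover, ContinuousMap.coe_mk]
  congr 1
  field_simp

lemma isCoveringMap_circleCover : IsCoveringMap circleCover :=
  Circle.isCoveringMap_exp.comp_homeomorph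
    (Homeomorph.mulLeft₀ (2 * Real.pi) (by positivity [Real.pi_pos]))

/-- Scaling contracts the cube to `0`, so this is homotopy lifting started from a constant map. -/
lemma exists_lift_cube {n : ℕ} (a : C(Fin n → I, Circle)) :
    ∃ l : C(Fin n → I, ℝ), ∀ p, circleCover (l p) = a p := by
  obtain ⟨s, hs⟩ := circleCover_surjective (a 0)
  let H : C(I × (Fin n → I), Circle) := ⟨fun z => a fun i => z.1 * z.2 i, by fun_prop⟩
  have hH : ∀ p, H (0, p) = circleCover (ContinuousMap.const (Fin n → I) s p) := fun p => by
    rw [ContinuousMap.const_apply, hs]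
    exact congrArg a (funext fun i => by simp)
  let L := isCoveringMap_circleCover.liftHomotopy H (ContinuousMap.const _ s) hH
  refine ⟨⟨fun p => L (1, p), by fun_prop⟩, fun p => ?_⟩
  have := congrFun (isCoveringMap_circleCover.liftHomotopy_lifts H (ContinuousMap.const _ s) hH)
    (1, p)
  exact this.trans (congrArg a (funext fun i => by simp))

lemma eq_of_circleCover_eq_const {l : C(I, ℝ)} {x : Circle} (h : ∀ t, circleCover (l t) = x)
    (s t : I) : l s = l t := by
  have := isCoveringMap_circleCover.eq_of_comp_eq (g₁ := l) (g₂ := fun _ => l t) l.continuous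
    continuous_const (funext fun r => (h r).trans (h t).symm) t rfl
  exact congrFun this s

/-- The boundary is path connected for `n ≥ 2`. From a point of a face in direction `i`, scale the
other coordinates to `0` within that face; some coordinate `j ≠ i` is now `0`, so coordinate `i` can
be scaled to `0` within a face in direction `j`. The lift is constant along both paths. -/
lemma lift_eq_on_boundary {n : ℕ} (hn : 2 ≤ n) {l : C(Fin n → I, ℝ)} {x : Circle}
    (h : ∀ p ∈ Cube.boundary (Fin n), circleCover (l p) = x) {p : Fin n → I}
    (hp : p ∈ Cube.boundary (Fin n)) : l p = l 0 := by
  obtain ⟨i, hi⟩ := hp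
  have : Nontrivial (Fin n) := Fin.nontrivial_iff_two_le.2 hn
  obtain ⟨j, hj⟩ := exists_ne i
  let α : C(I, ℝ) := ⟨fun t => l fun k => if k = i then p i else t * p k, by
    refine l.continuous.comp (continuous_pi fun k => ?_)
    split_ifs <;> fun_prop⟩
  let β : C(I, ℝ) := ⟨fun t => l fun k => if k = i then t * p i else 0, by
    refine l.continuous.comp (continuous_pi fun k => ?_)
    split_ifs <;> fun_prop⟩
  have hα := eq_of_circleCover_eq_const (l := α) (fun t => h _ ⟨i, by simpa using hi⟩) 1 0
  have hβ := eq_of_circleCover_eq_const (l := β) (fun t => h _ ⟨j, by simp [hj]⟩) 1 0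
  calc l p = α 1 := congrArg l (funext fun k => by split_ifs with hk <;> simp [hk])
    _ = α 0 := hα
    _ = β 1 := congrArg l (funext fun k => by split_ifs with hk <;> simp)
    _ = β 0 := hβ
    _ = l 0 := congrArg l (funext fun k => by split_ifs with hk <;> simp)

/-- The path `a` in the circle has a lift to the line which increases by `k`. -/
def HasWinding {x y : Circle} (a : Path x y) (k : ℝ) : Prop :=
  ∃ l : C(I, ℝ), (∀ t, circleCover (l t) = a t) ∧ l 1 - l 0 = k

lemma exists_hasWinding {x y : Circle} (a : Path x y) : ∃ k, HasWinding a k := by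
  obtain ⟨s, hs⟩ := circleCover_surjective x
  exact ⟨_, isCoveringMap_circleCover.liftPath a s (by simp [hs]),
    fun t => congrFun (isCoveringMap_circleCover.liftPath_lifts a s (by simp [hs])) t, rfl⟩

namespace HasWinding

variable {x y z : Circle} {a b : Path x y} {k k' : ℝ}

lemma exists_lift (h : HasWinding a k) {s : ℝ} (hs : circleCover s = x) :
    ∃ l : C(I, ℝ), (∀ t, circleCover (l t) = a t) ∧ l 0 = s ∧ l 1 = s + k := by
  obtain ⟨l, hl, hk⟩ := h
  obtain ⟨n, hn⟩ := circleCover_eq_iff.1 (hs.trans ((hl 0).trans a.source).symm)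
  refine ⟨⟨fun t => l t + n, by fun_prop⟩, fun t => ?_, hn.symm, ?_⟩
  · simp [circleCover_add, hl]
  · simp only [ContinuousMap.coe_mk]; linarith

/-- Homotopic paths have lifts with the same endpoint once these start together; conversely, lifts
with common endpoints can be interpolated linearly. -/
lemma homotopic_iff (ha : HasWinding a k) (hb : HasWinding b k') : a.Homotopic b ↔ k = k' := by
  obtain ⟨s, hs⟩ := circleCover_surjective x
  obtain ⟨l, hl, hl0, hl1⟩ := ha.exists_lift hs
  obtain ⟨l', hl', hl'0, hl'1⟩ := hb.exists_lift hs
  have e : l = isCoveringMap_circleCover.liftPath a.toContinuousMap s (by simp [hs]) :=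
    (isCoveringMap_circleCover.eq_liftPath_iff' _).2 ⟨funext hl, hl0⟩
  have e' : l' = isCoveringMap_circleCover.liftPath b.toContinuousMap s (by simp [hs]) :=
    (isCoveringMap_circleCover.eq_liftPath_iff' _).2 ⟨funext hl', hl'0⟩
  constructor
  · intro h
    have := isCoveringMap_circleCover.liftPath_apply_one_eq_of_homotopicRel h s
      (by simp [hs]) (by simp [hs])
    rw [← e, ← e', hl1, hl'1] at this
    linarith
  · rintro rfl
    refine ⟨⟨⟨⟨fun z => circleCover ((1 - (z.1 : ℝ)) * l z.2 + z.1 * l' z.2), by fun_prop⟩,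
      fun t => by simp [hl], fun t => by simp [hl']⟩, ?_⟩⟩
    rintro r t (rfl | rfl)
    · change circleCover ((1 - (r : ℝ)) * l 0 + r * l' 0) = a 0
      rw [← hl, hl0, hl'0]; congr 1; ring
    · change circleCover ((1 - (r : ℝ)) * l 1 + r * l' 1) = a 1
      rw [← hl, hl1, hl'1]; congr 1; ring

lemma exists_int {a : Path x x} (h : HasWinding a k) : ∃ n : ℤ, k = n := by
  obtain ⟨l, hl, hk⟩ := h
  obtain ⟨n, hn⟩ := circleCover_eq_iff.1 ((hl 1).trans (a.target.trans (a.source.symm.trans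
    (hl 0).symm)))
  exact ⟨n, by linarith⟩

lemma trans {c : Path y z} (ha : HasWinding a k) (hc : HasWinding c k') :
    HasWinding (a.trans c) (k + k') := by
  obtain ⟨l, hl, hk⟩ := ha
  obtain ⟨l', hl', h0, h1⟩ := hc.exists_lift (s := l 1) ((hl 1).trans a.target)
  let p : Path (l 0) (l 1) := ⟨l, rfl, rfl⟩
  let q : Path (l 1) (l' 1) := ⟨l', h0, rfl⟩
  refine ⟨(p.trans q).toContinuousMap, fun t => ?_, ?_⟩
  · change circleCover ((p.trans q) t) = _
    simp only [Path.trans_apply]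
    split_ifs
    exacts [hl _, hl' _]
  · change (p.trans q) 1 - (p.trans q) 0 = _
    rw [Path.target, Path.source]
    linarith

lemma symm (ha : HasWinding a k) : HasWinding a.symm (-k) := by
  obtain ⟨l, hl, hk⟩ := ha
  refine ⟨⟨fun t => l (σ t), by fun_prop⟩, fun t => hl _, ?_⟩
  simp only [ContinuousMap.coe_mk, unitInterval.symm_one, unitInterval.symm_zero]
  linarith

end HasWinding

/-- The loop `t ↦ x exp(2πikt)`. -/
def circleTurn (x : Circle) (k : ℤ) : Path x x where
  toFun t := x * circleCover (k * (t : ℝ))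
  continuous_toFun := by fun_prop
  source' := by simp
  target' := by simp

lemma hasWinding_circleTurn (x : Circle) (k : ℤ) : HasWinding (circleTurn x k) k := by
  obtain ⟨s, rfl⟩ := circleCover_surjective x
  exact ⟨⟨fun t => s + k * (t : ℝ), by fun_prop⟩, fun t => circleCover_add _ _, by simp⟩

/-- Winding numbers add under concatenation, so `k ↦ circleTurn 1 k` induces a homomorphism from
`ℤ`, which is determined by its value at `1`. -/
lemma circleGenerator_zpow (k : ℤ) : circleGenerator ^ k =
    FundamentalGroup.fromPath (Path.Homotopic.Quotient.mk (circleTurn 1 k)) := by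
  let φ : Multiplicative ℤ →* FundamentalGroup Circle 1 := MonoidHom.mk'
    (fun k => FundamentalGroup.fromPath (Path.Homotopic.Quotient.mk (circleTurn 1 k.toAdd)))
    (fun j k => by
      refine (Path.Homotopic.Quotient.eq.2 ?_).trans (Path.Homotopic.Quotient.mk_trans _ _)
      refine ((hasWinding_circleTurn 1 _).homotopic_iff
        ((hasWinding_circleTurn 1 _).trans (hasWinding_circleTurn 1 _))).2 ?_
      rw [toAdd_mul]; push_cast; ring)
  have h1 : φ (Multiplicative.ofAdd 1) = circleGenerator := by
    refine congrArg (fun p => FundamentalGroup.fromPath (Path.Homotopic.Quotient.mk p)) ?_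
    ext t
    simp [circleTurn, circleLoop, circleCover]
  have : φ (Multiplicative.ofAdd k) = φ (Multiplicative.ofAdd 1) ^ k := by
    rw [← map_zpow, ← ofAdd_zsmul]; simp
  rw [← h1, ← this]
  rfl

lemma HasWinding.mk_eq {a : Path (1 : Circle) 1} {k : ℤ} (h : HasWinding a k) :
    FundamentalGroup.fromPath (Path.Homotopic.Quotient.mk a) = circleGenerator ^ k := by
  rw [circleGenerator_zpow]
  exact Path.Homotopic.Quotient.eq.2 ((h.homotopic_iff (hasWinding_circleTurn 1 k)).2 rfl)

lemma circleGenerator_zpow_injective :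
    Function.Injective (fun k : ℤ => circleGenerator ^ k) := by
  intro j k h
  simp only [circleGenerator_zpow] at h
  exact_mod_cast ((hasWinding_circleTurn 1 j).homotopic_iff (hasWinding_circleTurn 1 k)).1
    (Path.Homotopic.Quotient.eq.1 h)

lemma exists_eq_circleGenerator_zpow (γ : FundamentalGroup Circle 1) :
    ∃ k : ℤ, γ = circleGenerator ^ k := by
  obtain ⟨a, rfl⟩ := Path.Homotopic.Quotient.mk_surjective γ
  obtain ⟨r, hr⟩ := exists_hasWinding a
  obtain ⟨k, rfl⟩ := hr.exists_int
  exact ⟨k, hr.mk_eq⟩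

/-- The fundamental group of the circle is `ℤ`. -/
def circleFundamentalGroupEquiv : Multiplicative ℤ ≃* FundamentalGroup Circle 1 :=
  MulEquiv.ofBijective (zpowersHom _ circleGenerator)
    ⟨fun _ _ h => Multiplicative.toAdd.injective (circleGenerator_zpow_injective h),
      fun γ => by
        obtain ⟨k, rfl⟩ := exists_eq_circleGenerator_zpow γ
        exact ⟨Multiplicative.ofAdd k, rfl⟩⟩

/-! ### Prism filling and homotopies built from lifts -/

lemma isClosed_cubeBoundary (n : ℕ) : IsClosed (Cube.boundary (Fin n)) := by
  have : Cube.boundary (Fin n) = ⋃ i : Fin n, {p | p i = 0} ∪ {p | p i = 1} := by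
    ext p; simp [Cube.boundary]
  rw [this]
  exact isClosed_iUnion_of_finite fun i =>
    (isClosed_eq (continuous_apply i) continuous_const).union
      (isClosed_eq (continuous_apply i) continuous_const)

/-- In a groupoid, compatible maps on the faces of a cube of dimension at least three extend. -/
theorem IsHomotopyGroupoid.exists_prism {B : Type*} [TopologicalSpace B]
    (hB : IsHomotopyGroupoid B) {k : ℕ} (hk : 1 ≤ k) (l s₀ s₁ t₀ t₁ : C((Fin k → I) × I × I, B))
    (hls₀ : ∀ p ∈ Cube.boundary (Fin k), ∀ t, l (p, 0, t) = s₀ (p, 0, t))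
    (hls₁ : ∀ p ∈ Cube.boundary (Fin k), ∀ t, l (p, 1, t) = s₁ (p, 1, t))
    (hlt₀ : ∀ p ∈ Cube.boundary (Fin k), ∀ s, l (p, s, 0) = t₀ (p, s, 0))
    (hlt₁ : ∀ p ∈ Cube.boundary (Fin k), ∀ s, l (p, s, 1) = t₁ (p, s, 1))
    (h₀₀ : ∀ p, s₀ (p, 0, 0) = t₀ (p, 0, 0)) (h₀₁ : ∀ p, s₀ (p, 0, 1) = t₁ (p, 0, 1))
    (h₁₀ : ∀ p, s₁ (p, 1, 0) = t₀ (p, 1, 0)) (h₁₁ : ∀ p, s₁ (p, 1, 1) = t₁ (p, 1, 1)) :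
    ∃ G : C((Fin k → I) × I × I, B),
      (∀ p ∈ Cube.boundary (Fin k), ∀ s t, G (p, s, t) = l (p, s, t)) ∧
      (∀ p t, G (p, 0, t) = s₀ (p, 0, t)) ∧ (∀ p t, G (p, 1, t) = s₁ (p, 1, t)) ∧
      (∀ p s, G (p, s, 0) = t₀ (p, s, 0)) ∧ (∀ p s, G (p, s, 1) = t₁ (p, s, 1)) := by
  classical
  let u : (Fin k → I) × I × I → B := fun z =>
    if z.1 ∈ Cube.boundary (Fin k) then l z else if z.2.1 = 0 then s₀ z else
    if z.2.1 = 1 then s₁ z else if z.2.2 = 0 then t₀ z else t₁ z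
  have ul : ∀ p ∈ Cube.boundary (Fin k), ∀ s t, u (p, s, t) = l (p, s, t) := fun p hp s t =>
    if_pos hp
  have us₀ : ∀ p t, u (p, 0, t) = s₀ (p, 0, t) := fun p t => by
    by_cases hp : p ∈ Cube.boundary (Fin k)
    · rw [ul p hp, hls₀ p hp]
    · simp [u, hp]
  have us₁ : ∀ p t, u (p, 1, t) = s₁ (p, 1, t) := fun p t => by
    by_cases hp : p ∈ Cube.boundary (Fin k)
    · rw [ul p hp, hls₁ p hp]
    · simp [u, hp]
  have ut₀ : ∀ p s, u (p, s, 0) = t₀ (p, s, 0) := fun p s => by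
    by_cases hp : p ∈ Cube.boundary (Fin k)
    · rw [ul p hp, hlt₀ p hp]
    by_cases h0 : s = 0
    · rw [h0, us₀, h₀₀]
    by_cases h1 : s = 1
    · rw [h1, us₁, h₁₀]
    · simp [u, hp, h0, h1]
  have ut₁ : ∀ p s, u (p, s, 1) = t₁ (p, s, 1) := fun p s => by
    by_cases hp : p ∈ Cube.boundary (Fin k)
    · rw [ul p hp, hlt₁ p hp]
    by_cases h0 : s = 0
    · rw [h0, us₀, h₀₁]
    by_cases h1 : s = 1
    · rw [h1, us₁, h₁₁]
    · simp [u, hp, h0, h1]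
  have cl : IsClosed {z : (Fin k → I) × I × I | z.1 ∈ Cube.boundary (Fin k)} :=
    (isClosed_cubeBoundary k).preimage continuous_fst
  have cs : ∀ c : I, IsClosed {z : (Fin k → I) × I × I | z.2.1 = c} := fun c =>
    isClosed_eq (by fun_prop) continuous_const
  have ct : ∀ c : I, IsClosed {z : (Fin k → I) × I × I | z.2.2 = c} := fun c =>
    isClosed_eq (by fun_prop) continuous_const
  -- On each closed face `u` coincides with one of the continuous data, the overlaps being
  -- compatible, so the pieces paste.
  have hu : ContinuousOn u (prismBoundary k) := by
    refine ContinuousOn.union_of_isClosed (l.continuous.continuousOn.congr ?_)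
      (ContinuousOn.union_of_isClosed
        (ContinuousOn.union_of_isClosed (s₀.continuous.continuousOn.congr ?_)
          (s₁.continuous.continuousOn.congr ?_) (cs 0) (cs 1))
        (ContinuousOn.union_of_isClosed (t₀.continuous.continuousOn.congr ?_)
          (t₁.continuous.continuousOn.congr ?_) (ct 0) (ct 1))
        ((cs 0).union (cs 1)) ((ct 0).union (ct 1))) cl
      (((cs 0).union (cs 1)).union ((ct 0).union (ct 1)))
    · rintro ⟨p, s, t⟩ hz
      exact ul p hz s t
    · rintro ⟨p, s, t⟩ (rfl : s = 0)
      exact us₀ p t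
    · rintro ⟨p, s, t⟩ (rfl : s = 1)
      exact us₁ p t
    · rintro ⟨p, s, t⟩ (rfl : t = 0)
      exact ut₀ p s
    · rintro ⟨p, s, t⟩ (rfl : t = 1)
      exact ut₁ p s
  obtain ⟨G, hG⟩ := hB.exists_extension hk u hu
  exact ⟨G, fun p hp s t => (hG _ (Or.inl hp)).trans (ul p hp s t),
    fun p t => (hG _ (Or.inr (Or.inl (Or.inl rfl)))).trans (us₀ p t),
    fun p t => (hG _ (Or.inr (Or.inl (Or.inr rfl)))).trans (us₁ p t),
    fun p s => (hG _ (Or.inr (Or.inr (Or.inl rfl)))).trans (ut₀ p s),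
    fun p s => (hG _ (Or.inr (Or.inr (Or.inr rfl)))).trans (ut₁ p s)⟩

/-- The straight-line homotopy between the circle-valued maps with given lifts. -/
def lineHomotopy {A : Type*} [TopologicalSpace A] (a₀ a₁ : C(A, ℝ)) : C(I × A, Circle) :=
  ⟨fun z => circleCover ((1 - (z.1 : ℝ)) * a₀ z.2 + z.1 * a₁ z.2), by fun_prop⟩

section

variable {A : Type*} [TopologicalSpace A] (a₀ a₁ : C(A, ℝ)) (p : A)

@[simp]
lemma lineHomotopy_zero : lineHomotopy a₀ a₁ (0, p) = circleCover (a₀ p) := by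
  simp [lineHomotopy]

@[simp]
lemma lineHomotopy_one : lineHomotopy a₀ a₁ (1, p) = circleCover (a₁ p) := by
  simp [lineHomotopy]

lemma lineHomotopy_of_eq {a₀ a₁ : C(A, ℝ)} {p : A} (h : a₀ p = a₁ p) (s : I) :
    lineHomotopy a₀ a₁ (s, p) = circleCover (a₀ p) := by
  simp only [lineHomotopy, ContinuousMap.coe_mk, ← h]
  congr 1; ring

end

lemma torus_homotopicRel {A : Type*} [TopologicalSpace A] {S : Set A}
    {u₀ u₁ : C(A, Circle × Circle)} {a₀ a₁ b₀ b₁ : C(A, ℝ)}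
    (ha₀ : ∀ p, circleCover (a₀ p) = (u₀ p).1) (ha₁ : ∀ p, circleCover (a₁ p) = (u₁ p).1)
    (hb₀ : ∀ p, circleCover (b₀ p) = (u₀ p).2) (hb₁ : ∀ p, circleCover (b₁ p) = (u₁ p).2)
    (ha : ∀ p ∈ S, a₀ p = a₁ p) (hb : ∀ p ∈ S, b₀ p = b₁ p) : u₀.HomotopicRel u₁ S := by
  refine ⟨⟨⟨(lineHomotopy a₀ a₁).prodMk (lineHomotopy b₀ b₁), fun p => ?_, fun p => ?_⟩,
    fun s p hp => ?_⟩⟩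
  · simp [ha₀, hb₀]
  · simp [ha₁, hb₁]
  · change (lineHomotopy a₀ a₁ (s, p), lineHomotopy b₀ b₁ (s, p)) = u₀ p
    rw [lineHomotopy_of_eq (ha p hp), lineHomotopy_of_eq (hb p hp), ha₀, hb₀]

variable {B : Type*} [TopologicalSpace B]

/-- The circle coordinates follow the line homotopies. The path coordinate fills a cube with
parameters `(p, s, t)`, where `s` is homotopy time and `t` path time: the faces `s = 0, 1` come from
`u₀`, `u₁`, and the faces `t = 0, 1` from `f` along the two line homotopies. -/
lemma pullback_homotopicRel (hB : IsHomotopyGroupoid B) {f : C(Circle, B)} {n : ℕ} (hn : 1 ≤ n)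
    {u₀ u₁ : C(Fin n → I, HomotopyPullback f f)} {a₀ a₁ b₀ b₁ : C(Fin n → I, ℝ)}
    (ha₀ : ∀ p, circleCover (a₀ p) = (u₀ p).1.1) (ha₁ : ∀ p, circleCover (a₁ p) = (u₁ p).1.1)
    (hb₀ : ∀ p, circleCover (b₀ p) = (u₀ p).1.2.1) (hb₁ : ∀ p, circleCover (b₁ p) = (u₁ p).1.2.1)
    (hu : ∀ p ∈ Cube.boundary (Fin n), u₀ p = u₁ p)
    (ha : ∀ p ∈ Cube.boundary (Fin n), a₀ p = a₁ p)
    (hb : ∀ p ∈ Cube.boundary (Fin n), b₀ p = b₁ p) :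
    u₀.HomotopicRel u₁ (Cube.boundary (Fin n)) := by
  let s₀ : C((Fin n → I) × I × I, B) := ⟨fun z => (u₀ z.1).1.2.2 z.2.2, by fun_prop⟩
  let s₁ : C((Fin n → I) × I × I, B) := ⟨fun z => (u₁ z.1).1.2.2 z.2.2, by fun_prop⟩
  let t₀ : C((Fin n → I) × I × I, B) := ⟨fun z => f (lineHomotopy a₀ a₁ (z.2.1, z.1)), by fun_prop⟩
  let t₁ : C((Fin n → I) × I × I, B) := ⟨fun z => f (lineHomotopy b₀ b₁ (z.2.1, z.1)), by fun_prop⟩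
  -- The lateral data are `s₀`, independent of `s`, which makes the homotopy stationary over the
  -- boundary.
  obtain ⟨G, Gl, Gs₀, Gs₁, Gt₀, Gt₁⟩ := hB.exists_prism hn s₀ s₀ s₁ t₀ t₁
    (fun p hp t => rfl) (fun p hp t => by simp [s₀, s₁, hu p hp])
    (fun p hp s => by simp [s₀, t₀, lineHomotopy_of_eq (ha p hp), ha₀, (u₀ p).2.1])
    (fun p hp s => by simp [s₀, t₁, lineHomotopy_of_eq (hb p hp), hb₀, (u₀ p).2.2])
    (fun p => by simp [s₀, t₀, ha₀, (u₀ p).2.1]) (fun p => by simp [s₀, t₁, hb₀, (u₀ p).2.2])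
    (fun p => by simp [s₁, t₀, ha₁, (u₁ p).2.1]) (fun p => by simp [s₁, t₁, hb₁, (u₁ p).2.2])
  let g : C(I × (Fin n → I), C(I, B)) :=
    ContinuousMap.curry ⟨fun z => G (z.1.2, z.1.1, z.2), by fun_prop⟩
  refine ⟨⟨⟨⟨fun z => ⟨(lineHomotopy a₀ a₁ z, lineHomotopy b₀ b₁ z, g z),
    Gt₀ z.2 z.1, Gt₁ z.2 z.1⟩, by fun_prop⟩, fun p => ?_, fun p => ?_⟩, fun s p hp => ?_⟩⟩
  · refine Subtype.ext (Prod.ext ?_ (Prod.ext ?_ (ContinuousMap.ext fun t => Gs₀ p t)))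
    · simp [ha₀]
    · simp [hb₀]
  · refine Subtype.ext (Prod.ext ?_ (Prod.ext ?_ (ContinuousMap.ext fun t => Gs₁ p t)))
    · simp [ha₁]
    · simp [hb₁]
  · refine Subtype.ext (Prod.ext ?_ (Prod.ext ?_ (ContinuousMap.ext fun t => Gl p hp s t)))
    · exact (lineHomotopy_of_eq (ha p hp) s).trans (ha₀ p)
    · exact (lineHomotopy_of_eq (hb p hp) s).trans (hb₀ p)

/-! ### Vanishing of the higher homotopy groups -/

/-- A space is a groupoid if all spheres of dimension at least two in it are contractible. -/
lemma isHomotopyGroupoid_of_homotopic {X : Type*} [TopologicalSpace X]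
    (h : ∀ n, 2 ≤ n → ∀ (x : X) (γ : GenLoop (Fin n) X x), GenLoop.Homotopic γ GenLoop.const) :
    IsHomotopyGroupoid X := by
  refine fun n hn x => ⟨fun a b => ?_⟩
  induction a using Quotient.inductionOn
  induction b using Quotient.inductionOn
  exact Quotient.sound ((h n hn x _).trans (h n hn x _).symm)

lemma isHomotopyGroupoid_torus : IsHomotopyGroupoid (Circle × Circle) := by
  refine isHomotopyGroupoid_of_homotopic fun n hn x γ => ?_
  obtain ⟨a, ha⟩ := exists_lift_cube (ContinuousMap.fst.comp γ.1)
  obtain ⟨b, hb⟩ := exists_lift_cube (ContinuousMap.snd.comp γ.1)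
  have ha' : ∀ p ∈ Cube.boundary (Fin n), circleCover (a p) = x.1 := fun p hp =>
    (ha p).trans (congrArg Prod.fst (γ.2 p hp))
  have hb' : ∀ p ∈ Cube.boundary (Fin n), circleCover (b p) = x.2 := fun p hp =>
    (hb p).trans (congrArg Prod.snd (γ.2 p hp))
  have h0 : (0 : Fin n → I) ∈ Cube.boundary (Fin n) := ⟨⟨0, by omega⟩, Or.inl rfl⟩
  exact torus_homotopicRel (a₁ := ContinuousMap.const _ (a 0)) (b₁ := ContinuousMap.const _ (b 0))
    ha (fun p => ha' 0 h0) hb (fun p => hb' 0 h0)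
    (fun p hp => lift_eq_on_boundary hn ha' hp) (fun p hp => lift_eq_on_boundary hn hb' hp)

/-- For `n ≥ 2` the two lifts of a based cube are constant on the boundary, so they agree there with
the constant lifts of the constant cube, and `pullback_homotopicRel` applies. -/
theorem isHomotopyGroupoid_pullback (hB : IsHomotopyGroupoid B) (f : C(Circle, B)) :
    IsHomotopyGroupoid (HomotopyPullback f f) := by
  refine isHomotopyGroupoid_of_homotopic fun n hn x γ => ?_
  obtain ⟨a, ha⟩ := exists_lift_cube ((HomotopyPullback.fst f f).comp γ.1)
  obtain ⟨b, hb⟩ := exists_lift_cube ((HomotopyPullback.snd f f).comp γ.1)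
  have ha' : ∀ p ∈ Cube.boundary (Fin n), circleCover (a p) = x.1.1 := fun p hp =>
    (ha p).trans (congrArg (fun r : HomotopyPullback f f => r.1.1) (γ.2 p hp))
  have hb' : ∀ p ∈ Cube.boundary (Fin n), circleCover (b p) = x.1.2.1 := fun p hp =>
    (hb p).trans (congrArg (fun r : HomotopyPullback f f => r.1.2.1) (γ.2 p hp))
  have h0 : (0 : Fin n → I) ∈ Cube.boundary (Fin n) := ⟨⟨0, by omega⟩, Or.inl rfl⟩
  exact pullback_homotopicRel hB (by omega) (a₁ := ContinuousMap.const _ (a 0))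
    (b₁ := ContinuousMap.const _ (b 0)) ha (fun p => ha' 0 h0) hb (fun p => hb' 0 h0)
    (fun p hp => γ.2 p hp)
    (fun p hp => lift_eq_on_boundary hn ha' hp) (fun p hp => lift_eq_on_boundary hn hb' hp)

/-! ### Loops are determined by their winding numbers -/

lemma Path.Homotopic.of_genLoop {X : Type*} [TopologicalSpace X] {x : X} {p q : Path x x}
    (h : GenLoop.Homotopic ((genLoopEquivOfUnique (Fin 1)).symm p)
      ((genLoopEquivOfUnique (Fin 1)).symm q)) : p.Homotopic q :=
  Path.Homotopic.Quotient.eq.1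
    (congrArg (homotopyGroupEquivFundamentalGroupOfUnique (Fin 1)) (Quotient.sound h))

lemma torus_homotopic {x : Circle × Circle} {p q : Path x x} {j k : ℝ}
    (hp₁ : HasWinding (p.map continuous_fst) j) (hp₂ : HasWinding (p.map continuous_snd) k)
    (hq₁ : HasWinding (q.map continuous_fst) j) (hq₂ : HasWinding (q.map continuous_snd) k) :
    p.Homotopic q := by
  obtain ⟨s, hs⟩ := circleCover_surjective x.1
  obtain ⟨t, ht⟩ := circleCover_surjective x.2
  obtain ⟨a₀, ha₀, ha₀0, ha₀1⟩ := hp₁.exists_lift hs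
  obtain ⟨a₁, ha₁, ha₁0, ha₁1⟩ := hq₁.exists_lift hs
  obtain ⟨b₀, hb₀, hb₀0, hb₀1⟩ := hp₂.exists_lift ht
  obtain ⟨b₁, hb₁, hb₁0, hb₁1⟩ := hq₂.exists_lift ht
  refine torus_homotopicRel ha₀ ha₁ hb₀ hb₁ ?_ ?_
  · rintro _ (rfl | rfl)
    exacts [ha₀0.trans ha₁0.symm, ha₀1.trans ha₁1.symm]
  · rintro _ (rfl | rfl)
    exacts [hb₀0.trans hb₁0.symm, hb₀1.trans hb₁1.symm]

/-- Lifts chosen with the same starting points also end together when the windings agree. This is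
the case `n = 1` of `pullback_homotopicRel`, which relies on `π_2(B) = 0`. -/
lemma pullback_homotopic (hB : IsHomotopyGroupoid B) {f : C(Circle, B)}
    {x : HomotopyPullback f f} {p q : Path x x} {j k : ℝ}
    (hp₁ : HasWinding (p.map (HomotopyPullback.fst f f).continuous) j)
    (hp₂ : HasWinding (p.map (HomotopyPullback.snd f f).continuous) k)
    (hq₁ : HasWinding (q.map (HomotopyPullback.fst f f).continuous) j)
    (hq₂ : HasWinding (q.map (HomotopyPullback.snd f f).continuous) k) :
    p.Homotopic q := by
  obtain ⟨s, hs⟩ := circleCover_surjective x.1.1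
  obtain ⟨t, ht⟩ := circleCover_surjective x.1.2.1
  obtain ⟨a₀, ha₀, ha₀0, ha₀1⟩ := hp₁.exists_lift hs
  obtain ⟨a₁, ha₁, ha₁0, ha₁1⟩ := hq₁.exists_lift hs
  obtain ⟨b₀, hb₀, hb₀0, hb₀1⟩ := hp₂.exists_lift ht
  obtain ⟨b₁, hb₁, hb₁0, hb₁1⟩ := hq₂.exists_lift ht
  let ev : C(Fin 1 → I, I) := ⟨fun c => c 0, by fun_prop⟩
  refine Path.Homotopic.of_genLoop (pullback_homotopicRel hB le_rfl (a₀ := a₀.comp ev)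
    (a₁ := a₁.comp ev) (b₀ := b₀.comp ev) (b₁ := b₁.comp ev) (fun c => ha₀ _) (fun c => ha₁ _)
    (fun c => hb₀ _) (fun c => hb₁ _) ?_ ?_ ?_)
  · intro c hc
    exact (GenLoop.boundary _ c hc).trans (GenLoop.boundary _ c hc).symm
  · rintro c ⟨i, hi⟩
    obtain rfl := Subsingleton.elim i 0
    change a₀ (c 0) = a₁ (c 0)
    rcases hi with hi | hi <;> rw [hi]
    exacts [ha₀0.trans ha₁0.symm, ha₀1.trans ha₁1.symm]
  · rintro c ⟨i, hi⟩
    obtain rfl := Subsingleton.elim i 0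
    change b₀ (c 0) = b₁ (c 0)
    rcases hi with hi | hi <;> rw [hi]
    exacts [hb₀0.trans hb₁0.symm, hb₀1.trans hb₁1.symm]

/-! ### Realizable winding numbers and path connectedness -/

lemma HasWinding.congr {x y x' y' : Circle} {a : Path x y} {b : Path x' y'} {k : ℝ}
    (h : HasWinding a k) (hab : ∀ t, a t = b t) : HasWinding b k := by
  obtain ⟨l, hl, hk⟩ := h
  exact ⟨l, fun t => (hl t).trans (hab t), hk⟩

/-- A homotopy from the concatenation of `p` and `γ` to `q` gives a square with sides `p`, `γ` and
the concatenation of `q` with a constant path. -/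
lemma Path.Homotopic.exists_square {X : Type*} [TopologicalSpace X] {x y z : X} {p : Path x y}
    {γ : Path y z} {q : Path x z} (h : (p.trans γ).Homotopic q) :
    ∃ S : C(I × I, X), (∀ t, S (0, t) = p t) ∧ (∀ t, S (1, t) = (q.trans (Path.refl z)) t) ∧
      (∀ s, S (s, 0) = x) ∧ ∀ s, S (s, 1) = γ s := by
  obtain ⟨K⟩ := h
  let r : ℝ → I := Set.projIcc 0 1 zero_le_one
  have hr : Continuous r := continuous_projIcc
  have r_of : ∀ (a : ℝ) (b : I), a = b → r a = b := by
    rintro _ b rfl; exact Set.projIcc_val _ b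
  -- The square is mapped to the domain of `K` so that its edge `s = 0` covers the first half of the
  -- side carrying `p.trans γ`, and `t = 1` the second half. The edge `s = 1` runs along the side
  -- carrying `q`, then back along the side where `K` is constantly `z`, hence the constant tail.
  refine ⟨⟨fun w => K (r ((w.1 : ℝ) * min 1 (2 - 2 * (w.2 : ℝ))),
    r ((1 - (w.1 : ℝ)) * ((w.2 : ℝ) / 2) + (w.1 : ℝ) * min 1 (2 * (w.2 : ℝ)))), by fun_prop⟩, fun t => ?_, fun t => ?_,
    fun s => ?_, fun s => ?_⟩ <;> simp only [ContinuousMap.coe_mk]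
  · rw [r_of _ 0 (by simp), K.apply_zero]
    rw [r_of _ ⟨(t : ℝ) / 2, by linarith [t.2.1], by linarith [t.2.2]⟩ (by simp)]
    refine (Path.trans_apply p γ _).trans ?_
    rw [dif_pos (by simp only; linarith [t.2.2])]
    exact congrArg p (Subtype.ext (by simp only; ring))
  · rw [Path.trans_apply]
    split_ifs with ht
    · rw [r_of _ 1 (by rw [min_eq_left (by linarith)]; simp), K.apply_one]
      exact congrArg q (r_of _ _ (by rw [min_eq_right (by linarith)]; simp))
    · rw [r_of (_ + _) 1 (by rw [min_eq_left (by linarith)]; simp)]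
      exact K.target _
  · rw [r_of (_ + _) 0 (by simp)]
    exact K.source _
  · rw [r_of _ 0 (by simp), K.apply_zero]
    rw [r_of _ ⟨(1 + (s : ℝ)) / 2, by linarith [s.2.1], by linarith [s.2.2]⟩ (by simp; ring)]
    refine (Path.trans_apply p γ _).trans ?_
    split_ifs with hs
    · have : s = 0 := Subtype.ext (le_antisymm (by simp only at hs; simp; linarith) s.2.1)
      subst this
      exact (congrArg p (Subtype.ext (by simp))).trans (p.target.trans γ.source.symm)
    · exact congrArg γ (Subtype.ext (by simp only; ring))

variable {f : C(Circle, B)}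

lemma map_zpow_eq_iff {j k : ℤ} :
    FundamentalGroup.map f 1 (circleGenerator ^ j) =
        FundamentalGroup.map f 1 (circleGenerator ^ k) ↔
      ((circleTurn 1 j).map f.continuous).Homotopic ((circleTurn 1 k).map f.continuous) := by
  rw [circleGenerator_zpow, circleGenerator_zpow]
  exact Path.Homotopic.Quotient.eq

/-- Exchanging the two parameters turns a homotopy rel endpoints between the image loops into a loop
of paths in `B`, based at the constant path. -/
lemma exists_loop_diag {j k : ℤ}
    (h : FundamentalGroup.map f 1 (circleGenerator ^ j) =
      FundamentalGroup.map f 1 (circleGenerator ^ k)) :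
    ∃ p : Path (HomotopyPullback.diag f 1) (HomotopyPullback.diag f 1),
      HasWinding (p.map (HomotopyPullback.fst f f).continuous) j ∧
      HasWinding (p.map (HomotopyPullback.snd f f).continuous) k := by
  obtain ⟨K⟩ := map_zpow_eq_iff.1 h
  let g : C(I, C(I, B)) := ContinuousMap.curry ⟨fun z => K (z.2, z.1), by fun_prop⟩
  refine ⟨⟨⟨fun t => ⟨(circleTurn 1 j t, circleTurn 1 k t, g t), K.apply_zero t, K.apply_one t⟩,
    by fun_prop⟩, ?_, ?_⟩, hasWinding_circleTurn 1 j, hasWinding_circleTurn 1 k⟩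
  · exact Subtype.ext (Prod.ext (Path.source _) (Prod.ext (Path.source _)
      (ContinuousMap.ext fun s => K.source s)))
  · exact Subtype.ext (Prod.ext (Path.target _) (Prod.ext (Path.target _)
      (ContinuousMap.ext fun s => K.target s)))

lemma map_zpow_eq_of_loop_diag {j k : ℤ}
    {p : Path (HomotopyPullback.diag f 1) (HomotopyPullback.diag f 1)}
    (hj : HasWinding (p.map (HomotopyPullback.fst f f).continuous) j)
    (hk : HasWinding (p.map (HomotopyPullback.snd f f).continuous) k) :
    FundamentalGroup.map f 1 (circleGenerator ^ j) =
      FundamentalGroup.map f 1 (circleGenerator ^ k) := by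
  rw [← HasWinding.mk_eq (a := p.map (HomotopyPullback.fst f f).continuous) hj,
    ← HasWinding.mk_eq (a := p.map (HomotopyPullback.snd f f).continuous) hk]
  refine Path.Homotopic.Quotient.eq.2 ⟨⟨⟨⟨fun z => (p z.2).1.2.2 z.1, by fun_prop⟩,
    fun t => (p t).2.1, fun t => (p t).2.2⟩, ?_⟩⟩
  rintro s t (rfl | rfl)
  · change (p 0).1.2.2 s = f (p 0).1.1
    rw [p.source]; rfl
  · change (p 1).1.2.2 s = f (p 1).1.1
    rw [p.target]; rfl

/-- Arbitrary paths `p`, `q` from `1` to the circle coordinates of `r` leave a defect, the loop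
`f(p) · γ · f(q)⁻¹`. It is the image of some `ℓ^k`, so preceding `q` by `k` turns removes it. -/
lemma joined_diag
    (hf : ∀ c : FundamentalGroup B (f 1), ∃ k : ℤ,
      FundamentalGroup.map f 1 (circleGenerator ^ k) = c) (r : HomotopyPullback f f) :
    Joined (HomotopyPullback.diag f 1) r := by
  let p : Path 1 r.1.1 := PathConnectedSpace.somePath _ _
  let q : Path 1 r.1.2.1 := PathConnectedSpace.somePath _ _
  let γ : Path (f r.1.1) (f r.1.2.1) := ⟨r.1.2.2, r.2.1, r.2.2⟩
  let fp := p.map f.continuous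
  let fq := q.map f.continuous
  obtain ⟨k, hk⟩ := hf (FundamentalGroup.fromPath
    (Path.Homotopic.Quotient.mk ((fp.trans γ).trans fq.symm)))
  let b := (circleTurn 1 k).trans q
  have hb : (fp.trans γ).Homotopic (b.map f.continuous) := by
    rw [circleGenerator_zpow] at hk
    have hk' : ((circleTurn 1 k).map f.continuous).Homotopic ((fp.trans γ).trans fq.symm) :=
      Path.Homotopic.Quotient.eq.1 hk
    rw [Path.map_trans]
    refine Path.Homotopic.symm (Path.Homotopic.trans (hk'.hcomp (Path.Homotopic.refl fq)) ?_)
    refine (Path.Homotopic.trans_assoc _ _ _).trans ?_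
    exact ((Path.Homotopic.refl _).hcomp (Path.Homotopic.symm_trans fq)).trans
      (Path.Homotopic.trans_refl _)
  obtain ⟨S, S0, S1, Sx, Sγ⟩ := hb.exists_square
  let g : C(I, C(I, B)) := ContinuousMap.curry ⟨fun z => S (z.2, z.1), by fun_prop⟩
  let b' := b.trans (Path.refl _)
  have hb' : ∀ t, S (1, t) = f (b' t) := fun t =>
    (S1 t).trans (congrArg (fun c : Path _ _ => c t)
      (Path.map_trans b (Path.refl _) f.continuous).symm)
  refine ⟨⟨⟨fun t => ⟨(p t, b' t, g t), S0 t, hb' t⟩, by fun_prop⟩, ?_, ?_⟩⟩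
  · exact Subtype.ext (Prod.ext p.source (Prod.ext b'.source
      (ContinuousMap.ext fun s => Sx s)))
  · exact Subtype.ext (Prod.ext p.target (Prod.ext b'.target
      (ContinuousMap.ext fun s => Sγ s)))

/-- The winding numbers of all loops in the homotopy pullback are those of loops at the diagonal
point. -/
lemma map_zpow_eq_of_loop [PathConnectedSpace (HomotopyPullback f f)] {j k : ℤ}
    {x : HomotopyPullback f f} {p : Path x x}
    (hj : HasWinding (p.map (HomotopyPullback.fst f f).continuous) j)
    (hk : HasWinding (p.map (HomotopyPullback.snd f f).continuous) k) :
    FundamentalGroup.map f 1 (circleGenerator ^ j) =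
      FundamentalGroup.map f 1 (circleGenerator ^ k) := by
  let δ : Path (HomotopyPullback.diag f 1) x := PathConnectedSpace.somePath _ _
  obtain ⟨c, hc⟩ := exists_hasWinding (δ.map (HomotopyPullback.fst f f).continuous)
  obtain ⟨d, hd⟩ := exists_hasWinding (δ.map (HomotopyPullback.snd f f).continuous)
  -- Conjugation by `δ` moves the loop to the diagonal point, and its contributions to the winding
  -- numbers cancel.
  refine map_zpow_eq_of_loop_diag (p := (δ.trans p).trans δ.symm) ?_ ?_
  · have := (hc.trans hj).trans hc.symm
    rw [add_neg_cancel_comm] at this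
    rw [Path.map_trans, Path.map_trans]
    exact this
  · have := (hd.trans hk).trans hd.symm
    rw [add_neg_cancel_comm] at this
    rw [Path.map_trans, Path.map_trans]
    exact this

/-! ### The map from the torus to the homotopy pullback -/

/-- The square, mapped onto the torus. -/
def squareToTorus : C(I × I, Circle × Circle) :=
  ⟨fun z => (circleCover z.1, circleCover z.2), by fun_prop⟩

lemma exists_circleCover_eq (x : Circle) : ∃ t : I, circleCover t = x := by
  obtain ⟨s, rfl⟩ := circleCover_surjective x
  refine ⟨⟨Int.fract s, Int.fract_nonneg s, (Int.fract_lt_one s).le⟩, ?_⟩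
  exact circleCover_eq_iff.2 ⟨-⌊s⌋, by simp [Int.fract, sub_eq_add_neg]⟩

lemma squareToTorus_surjective : Function.Surjective squareToTorus := fun z => by
  obtain ⟨s, hs⟩ := exists_circleCover_eq z.1
  obtain ⟨t, ht⟩ := exists_circleCover_eq z.2
  exact ⟨(s, t), Prod.ext hs ht⟩

lemma circleCover_eq_on_interval {s t : I} (h : circleCover s = circleCover t) :
    s = t ∨ (s = 0 ∨ s = 1) ∧ (t = 0 ∨ t = 1) := by
  obtain ⟨n, hn⟩ := circleCover_eq_iff.1 h
  have hs := s.2; have ht := t.2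
  have h1 : (n : ℝ) < 2 := by linarith [hs.2, ht.1]
  have h2 : (-2 : ℝ) < n := by linarith [hs.1, ht.2]
  have h1' : n < 2 := by exact_mod_cast h1
  have h2' : -2 < n := by exact_mod_cast h2
  obtain rfl | rfl | rfl : n = 0 ∨ n = 1 ∨ n = -1 := by omega
  · left; ext; simpa using hn
  · right
    push_cast at hn
    exact ⟨Or.inr (Subtype.ext (by simp only [Set.Icc.coe_one]; linarith [hs.2, ht.1])),
      Or.inl (Subtype.ext (by simp only [Set.Icc.coe_zero]; linarith [hs.2, ht.1]))⟩
  · right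
    push_cast at hn
    exact ⟨Or.inl (Subtype.ext (by simp only [Set.Icc.coe_zero]; linarith [hs.1, ht.2])),
      Or.inr (Subtype.ext (by simp only [Set.Icc.coe_one]; linarith [hs.1, ht.2]))⟩

lemma circleCover_of_endpoint {t : I} (h : t = 0 ∨ t = 1) : circleCover t = 1 := by
  rcases h with rfl | rfl
  · simp
  · simpa using circleCover_intCast 1

/-- If `f` sends the `m`-th power of the standard loop to a trivial loop, then the map
`(u, v) ↦ (u, u vᵐ)` from the torus to itself factors through the homotopy pullback. -/
theorem exists_torus_to_pullback (hB : IsHomotopyGroupoid B) {m : ℤ}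
    (hf : FundamentalGroup.map f 1 (circleGenerator ^ (0 : ℤ)) =
      FundamentalGroup.map f 1 (circleGenerator ^ m)) :
    ∃ T : C(Circle × Circle, HomotopyPullback f f), T (1, 1) = HomotopyPullback.diag f 1 ∧
      ∀ z, (T z).1.1 = z.1 ∧ (T z).1.2.1 = z.1 * z.2 ^ m := by
  obtain ⟨N⟩ := map_zpow_eq_iff.1 hf
  have N0 : ∀ t, N (0, t) = f 1 := fun t => (N.apply_zero t).trans (congrArg f (by
    simp [circleTurn]))
  have N1 : ∀ t : I, N (1, t) = f (circleCover t ^ m) := fun t =>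
    (N.apply_one t).trans (congrArg f (by simp [circleTurn, circleCover_intCast_mul]))
  have Ne : ∀ (r t : I), t = 0 ∨ t = 1 → N (r, t) = f 1 := by
    rintro r t (rfl | rfl)
    exacts [N.source r, N.target r]
  -- The parameters of the cube are lifts of `u` and `v`, then path time. The `u`-faces carry the
  -- nullhomotopy `N`, the `v`-faces constant paths at `f u`, and the ends of path time `f u` and `f
  -- (u vᵐ)`.
  let l : C((Fin 1 → I) × I × I, B) := ⟨fun z => N (z.2.2, z.2.1), by fun_prop⟩
  let s : C((Fin 1 → I) × I × I, B) := ⟨fun z => f (circleCover (z.1 0)), by fun_prop⟩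
  let e : C((Fin 1 → I) × I × I, B) :=
    ⟨fun z => f (circleCover (z.1 0) * circleCover z.2.1 ^ m), by fun_prop⟩
  have hbd : ∀ p ∈ Cube.boundary (Fin 1), circleCover (p 0) = 1 := by
    rintro p ⟨i, hi⟩
    obtain rfl := Subsingleton.elim i 0
    exact circleCover_of_endpoint hi
  have c0 : circleCover ((0 : I) : ℝ) = 1 := circleCover_of_endpoint (Or.inl rfl)
  have c1 : circleCover ((1 : I) : ℝ) = 1 := circleCover_of_endpoint (Or.inr rfl)
  obtain ⟨G, Gl, Gs₀, Gs₁, Gt₀, Gt₁⟩ := hB.exists_prism le_rfl l s s s e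
    (fun p hp t => (Ne t 0 (Or.inl rfl)).trans (congrArg f (hbd p hp).symm))
    (fun p hp t => (Ne t 1 (Or.inr rfl)).trans (congrArg f (hbd p hp).symm))
    (fun p hp t => (N0 t).trans (congrArg f (hbd p hp).symm))
    (fun p hp t => (N1 t).trans (congrArg f (by
      change _ = circleCover (p 0) * circleCover t ^ m
      rw [hbd p hp, one_mul])))
    (fun p => rfl)
    (fun p => congrArg f (by
      change circleCover (p 0) = circleCover (p 0) * circleCover ((0 : I) : ℝ) ^ m
      rw [c0, one_zpow, mul_one]))
    (fun p => rfl)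
    (fun p => congrArg f (by
      change circleCover (p 0) = circleCover (p 0) * circleCover ((1 : I) : ℝ) ^ m
      rw [c1, one_zpow, mul_one]))
  let g : C(I × I, C(I, B)) :=
    ContinuousMap.curry ⟨fun z => G (fun _ => z.1.1, z.1.2, z.2), by fun_prop⟩
  let τ : C(I × I, HomotopyPullback f f) :=
    ⟨fun z => ⟨(circleCover z.1, circleCover z.1 * circleCover z.2 ^ m, g z),
      Gt₀ _ z.2, Gt₁ _ z.2⟩, by fun_prop⟩
  -- Opposite `u`-faces carry the same data, as do opposite `v`-faces, so the filled cube descends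
  -- to the torus.
  have hfac : Function.FactorsThrough τ squareToTorus := by
    rintro ⟨x, t⟩ ⟨x', t'⟩ h
    have hx : circleCover x = circleCover x' := congrArg Prod.fst h
    have ht : circleCover t = circleCover t' := congrArg Prod.snd h
    refine Subtype.ext (Prod.ext hx (Prod.ext ?_ (ContinuousMap.ext fun r => ?_)))
    · change circleCover x * circleCover t ^ m = circleCover x' * circleCover t' ^ m
      rw [hx, ht]
    change G (fun _ => x, t, r) = G (fun _ => x', t', r)
    rcases circleCover_eq_on_interval hx with rfl | ⟨hx0, hx1⟩
    · rcases circleCover_eq_on_interval ht with rfl | ⟨rfl | rfl, rfl | rfl⟩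
      · rfl
      · rfl
      · rw [Gs₀, Gs₁]; rfl
      · rw [Gs₀, Gs₁]; rfl
      · rfl
    · rw [Gl _ ⟨0, hx0⟩, Gl _ ⟨0, hx1⟩]
      change N (r, t) = N (r, t')
      rcases circleCover_eq_on_interval ht with rfl | ⟨ht0, ht1⟩
      · rfl
      · rw [Ne r t ht0, Ne r t' ht1]
  have hq : Topology.IsQuotientMap squareToTorus :=
    squareToTorus.continuous.isClosedMap.isQuotientMap squareToTorus.continuous
      squareToTorus_surjective
  have hT : ∀ z, hq.lift τ hfac (squareToTorus z) = τ z := fun z =>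
    congrArg (fun k : C(_, HomotopyPullback f f) => k z) (hq.lift_comp τ hfac)
  refine ⟨hq.lift τ hfac, ?_, fun z => ?_⟩
  · have h00 : squareToTorus (0, 0) = (1, 1) := Prod.ext c0 c0
    rw [← h00, hT]
    refine Subtype.ext (Prod.ext c0 (Prod.ext ?_ (ContinuousMap.ext fun r => ?_)))
    · change circleCover ((0 : I) : ℝ) * circleCover ((0 : I) : ℝ) ^ m = 1
      simp
    · exact (Gs₀ _ r).trans (congrArg f c0)
  · obtain ⟨w, rfl⟩ := squareToTorus_surjective z
    rw [hT]
    exact ⟨rfl, rfl⟩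

/-! ### The torus map is a weak equivalence -/

lemma bijective_homotopyGroupMap_one_iff {X Y : Type*} [TopologicalSpace X] [TopologicalSpace Y]
    (f : C(X, Y)) (x : X) :
    Function.Bijective (homotopyGroupMap f 1 x) ↔
      Function.Bijective (FundamentalGroup.map f x) := by
  have h : FundamentalGroup.map f x ∘ HomotopyGroup.pi1EquivFundamentalGroup =
      HomotopyGroup.pi1EquivFundamentalGroup ∘ homotopyGroupMap f 1 x := by
    funext a
    induction a using Quotient.inductionOn
    rfl
  rw [← Equiv.comp_bijective (homotopyGroupMap f 1 x) HomotopyGroup.pi1EquivFundamentalGroup, ← h,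
    Equiv.bijective_comp]

/-- Lifts `a`, `b` of the coordinates of `p` give the lifts `a` and `a + m b`, so on windings the
map is `(j, k) ↦ (j, j + mk)`; both injectivity and surjectivity on `π_1` are read off from this. -/
lemma hasWinding_torus_map {T : C(Circle × Circle, HomotopyPullback f f)} {m : ℤ}
    (hT : ∀ z, (T z).1.1 = z.1 ∧ (T z).1.2.1 = z.1 * z.2 ^ m) {x : Circle × Circle} {p : Path x x}
    {j k : ℝ} (hj : HasWinding (p.map continuous_fst) j)
    (hk : HasWinding (p.map continuous_snd) k) :
    HasWinding ((p.map T.continuous).map (HomotopyPullback.fst f f).continuous) j ∧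
      HasWinding ((p.map T.continuous).map (HomotopyPullback.snd f f).continuous) (j + m * k) := by
  refine ⟨hj.congr fun t => (hT (p t)).1.symm, ?_⟩
  obtain ⟨a, ha, rfl⟩ := hj
  obtain ⟨b, hb, rfl⟩ := hk
  refine ⟨⟨fun t => a t + m * b t, by fun_prop⟩, fun t => ?_, ?_⟩
  · change circleCover (a t + m * b t) = (T (p t)).1.2.1
    rw [circleCover_add, circleCover_intCast_mul, ha, hb, (hT _).2]
    rfl
  · simp only [ContinuousMap.coe_mk]; ring

/-- Maps from the torus to the homotopy pullback covering `(u, v) ↦ (u, u vᵐ)` are weak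
equivalences. -/
theorem isWeakHomotopyEquiv_torus (hB : IsHomotopyGroupoid B)
    [PathConnectedSpace (HomotopyPullback f f)] {m : ℤ} (hm : m ≠ 0)
    (hf : ∀ j k : ℤ, FundamentalGroup.map f 1 (circleGenerator ^ j) =
      FundamentalGroup.map f 1 (circleGenerator ^ k) → m ∣ k - j)
    {T : C(Circle × Circle, HomotopyPullback f f)}
    (hT : ∀ z, (T z).1.1 = z.1 ∧ (T z).1.2.1 = z.1 * z.2 ^ m) : IsWeakHomotopyEquiv T := by
  refine ⟨fun y => ⟨1, PathConnectedSpace.joined _ _⟩, fun x x' _ => PathConnectedSpace.joined _ _,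
    fun n hn x => ?_⟩
  rcases hn.eq_or_lt with rfl | hn
  · rw [bijective_homotopyGroupMap_one_iff]
    constructor
    · intro a b hab
      obtain ⟨p, rfl⟩ := Path.Homotopic.Quotient.mk_surjective a
      obtain ⟨q, rfl⟩ := Path.Homotopic.Quotient.mk_surjective b
      have hpq : (p.map T.continuous).Homotopic (q.map T.continuous) :=
        Path.Homotopic.Quotient.eq.1 hab
      obtain ⟨j, hj⟩ := exists_hasWinding (p.map continuous_fst)
      obtain ⟨k, hk⟩ := exists_hasWinding (p.map continuous_snd)
      obtain ⟨j', hj'⟩ := exists_hasWinding (q.map continuous_fst)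
      obtain ⟨k', hk'⟩ := exists_hasWinding (q.map continuous_snd)
      obtain ⟨h1, h2⟩ := hasWinding_torus_map hT hj hk
      obtain ⟨h1', h2'⟩ := hasWinding_torus_map hT hj' hk'
      obtain rfl := (h1.homotopic_iff h1').1 (hpq.map (HomotopyPullback.fst f f))
      have e := (h2.homotopic_iff h2').1 (hpq.map (HomotopyPullback.snd f f))
      have hm' : (m : ℝ) ≠ 0 := by exact_mod_cast hm
      obtain rfl := mul_left_cancel₀ hm' (add_left_cancel e)
      exact Path.Homotopic.Quotient.eq.2 (torus_homotopic hj hk hj' hk')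
    · intro a
      obtain ⟨p, rfl⟩ := Path.Homotopic.Quotient.mk_surjective a
      obtain ⟨j, hj⟩ := exists_hasWinding (p.map (HomotopyPullback.fst f f).continuous)
      obtain ⟨k, hk⟩ := exists_hasWinding (p.map (HomotopyPullback.snd f f).continuous)
      obtain ⟨j, rfl⟩ := hj.exists_int
      obtain ⟨k, rfl⟩ := hk.exists_int
      -- The quotient `i = (k - j) / m` is the number of turns needed in the second factor of the
      -- torus.
      obtain ⟨i, hi⟩ := hf j k (map_zpow_eq_of_loop hj hk)
      let q : Path x x := (circleTurn x.1 j).prod (circleTurn x.2 i)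
      obtain ⟨h1, h2⟩ := hasWinding_torus_map (p := q) hT (hasWinding_circleTurn x.1 j)
        (hasWinding_circleTurn x.2 i)
      have e : (j : ℝ) + m * i = k := by
        have : j + m * i = k := by omega
        exact_mod_cast this
      rw [e] at h2
      exact ⟨FundamentalGroup.fromPath (Path.Homotopic.Quotient.mk q),
        Path.Homotopic.Quotient.eq.2 (pullback_homotopic hB h1 h2 hj hk)⟩
  · have := isHomotopyGroupoid_torus n hn x
    have := isHomotopyGroupoid_pullback hB f n hn (T x)
    exact ⟨fun _ _ _ => Subsingleton.elim _ _, fun y => ⟨default, Subsingleton.elim _ _⟩⟩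

/-! ### The loop group and the lattice of winding numbers -/

lemma circleFundamentalGroupEquiv_symm_apply {a : Path (1 : Circle) 1} {k : ℤ}
    (h : HasWinding a k) :
    circleFundamentalGroupEquiv.symm
      (FundamentalGroup.fromPath (Path.Homotopic.Quotient.mk a)) = Multiplicative.ofAdd k := by
  rw [h.mk_eq, MulEquiv.symm_apply_eq]
  rfl

/-- The loop group of the homotopy pullback, at the diagonal point. -/
theorem exists_pullback_fundamentalGroupEquiv (hB : IsHomotopyGroupoid B) {m : ℕ}
    (hf : ∀ j k : ℤ, FundamentalGroup.map f 1 (circleGenerator ^ j) =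
      FundamentalGroup.map f 1 (circleGenerator ^ k) ↔ (j : ZMod m) = k) :
    ∃ Φ : FundamentalGroup (HomotopyPullback f f) (HomotopyPullback.diag f 1) ≃*
        Multiplicative (cyclicPullback m),
      ∀ γ,
        FundamentalGroup.map (HomotopyPullback.fst f f) (HomotopyPullback.diag f 1) γ =
          circleGenerator ^ (Multiplicative.toAdd (Φ γ)).1.1 ∧
        FundamentalGroup.map (HomotopyPullback.snd f f) (HomotopyPullback.diag f 1) γ =
          circleGenerator ^ (Multiplicative.toAdd (Φ γ)).1.2 := by
  let d₁ := circleFundamentalGroupEquiv.symm.toMonoidHom.comp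
    (FundamentalGroup.map (HomotopyPullback.fst f f) (HomotopyPullback.diag f 1))
  let d₂ := circleFundamentalGroupEquiv.symm.toMonoidHom.comp
    (FundamentalGroup.map (HomotopyPullback.snd f f) (HomotopyPullback.diag f 1))
  have hd : ∀ (p : Path (HomotopyPullback.diag f 1) (HomotopyPullback.diag f 1)) (j k : ℤ),
      HasWinding (p.map (HomotopyPullback.fst f f).continuous) j →
      HasWinding (p.map (HomotopyPullback.snd f f).continuous) k →
      d₁ (Path.Homotopic.Quotient.mk p) = Multiplicative.ofAdd j ∧
      d₂ (Path.Homotopic.Quotient.mk p) = Multiplicative.ofAdd k := fun p j k hj hk =>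
    ⟨circleFundamentalGroupEquiv_symm_apply hj, circleFundamentalGroupEquiv_symm_apply hk⟩
  have hw : ∀ p : Path (HomotopyPullback.diag f 1) (HomotopyPullback.diag f 1), ∃ j k : ℤ,
      HasWinding (p.map (HomotopyPullback.fst f f).continuous) j ∧
      HasWinding (p.map (HomotopyPullback.snd f f).continuous) k := fun p => by
    obtain ⟨j, hj⟩ := exists_hasWinding (p.map (HomotopyPullback.fst f f).continuous)
    obtain ⟨k, hk⟩ := exists_hasWinding (p.map (HomotopyPullback.snd f f).continuous)
    obtain ⟨j, rfl⟩ := hj.exists_int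
    obtain ⟨k, rfl⟩ := hk.exists_int
    exact ⟨j, k, hj, hk⟩
  have hmem : ∀ γ, ((d₁ γ).toAdd, (d₂ γ).toAdd) ∈ cyclicPullback m := fun γ => by
    obtain ⟨p, rfl⟩ := Path.Homotopic.Quotient.mk_surjective γ
    obtain ⟨j, k, hj, hk⟩ := hw p
    rw [(hd p j k hj hk).1, (hd p j k hj hk).2]
    exact (hf j k).1 (map_zpow_eq_of_loop_diag hj hk)
  let φ : FundamentalGroup (HomotopyPullback f f) (HomotopyPullback.diag f 1) →*
      Multiplicative (cyclicPullback m) :=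
    MonoidHom.mk' (fun γ => Multiplicative.ofAdd ⟨_, hmem γ⟩) fun a b => by
      refine congrArg Multiplicative.ofAdd (Subtype.ext (Prod.ext ?_ ?_))
      · exact congrArg Multiplicative.toAdd (map_mul d₁ a b)
      · exact congrArg Multiplicative.toAdd (map_mul d₂ a b)
  -- Injectivity is the classification of loops by winding numbers; surjectivity is the construction
  -- of a loop from a homotopy in `B`.
  have hφ : Function.Bijective φ := by
    constructor
    · intro a b hab
      have h : ((d₁ a).toAdd, (d₂ a).toAdd) = ((d₁ b).toAdd, (d₂ b).toAdd) :=
        congrArg Subtype.val (Multiplicative.ofAdd.injective hab)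
      obtain ⟨p, rfl⟩ := Path.Homotopic.Quotient.mk_surjective a
      obtain ⟨q, rfl⟩ := Path.Homotopic.Quotient.mk_surjective b
      obtain ⟨j, k, hj, hk⟩ := hw p
      obtain ⟨j', k', hj', hk'⟩ := hw q
      rw [(hd p j k hj hk).1, (hd p j k hj hk).2, (hd q j' k' hj' hk').1,
        (hd q j' k' hj' hk').2] at h
      obtain ⟨rfl, rfl⟩ := Prod.mk.inj h
      exact Path.Homotopic.Quotient.eq.2 (pullback_homotopic hB hj hk hj' hk')
    · rintro ⟨⟨j, k⟩, hjk⟩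
      obtain ⟨p, hj, hk⟩ := exists_loop_diag ((hf j k).2 hjk)
      refine ⟨FundamentalGroup.fromPath (Path.Homotopic.Quotient.mk p),
        congrArg Multiplicative.ofAdd (Subtype.ext ?_)⟩
      exact Prod.ext (congrArg Multiplicative.toAdd (hd p j k hj hk).1)
        (congrArg Multiplicative.toAdd (hd p j k hj hk).2)
  refine ⟨MulEquiv.ofBijective φ hφ, fun γ => ⟨?_, ?_⟩⟩
  · exact (circleFundamentalGroupEquiv.apply_symm_apply
      (FundamentalGroup.map (HomotopyPullback.fst f f) (HomotopyPullback.diag f 1) γ)).symm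
  · exact (circleFundamentalGroupEquiv.apply_symm_apply
      (FundamentalGroup.map (HomotopyPullback.snd f f) (HomotopyPullback.diag f 1) γ)).symm

lemma mem_cyclicPullback_iff {m : ℕ} {p : ℤ × ℤ} :
    p ∈ cyclicPullback m ↔ (m : ℤ) ∣ p.2 - p.1 :=
  ZMod.intCast_eq_intCast_iff_dvd_sub _ _ _

/-- The basis `(1, 1), (0, m)` of the pullback `ℤ ×_{ℤ/m} ℤ`. -/
lemma nonempty_cyclicPullback_addEquiv {m : ℕ} (hm : 0 < m) :
    Nonempty (cyclicPullback m ≃+ ℤ × ℤ) := by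
  let φ : ℤ × ℤ →+ cyclicPullback m := AddMonoidHom.mk'
    (fun a => ⟨(a.1, a.1 + m * a.2), mem_cyclicPullback_iff.2 ⟨a.2, by ring⟩⟩) fun a b =>
      Subtype.ext (Prod.ext rfl (by
        change a.1 + b.1 + m * (a.2 + b.2) = a.1 + m * a.2 + (b.1 + m * b.2)
        ring))
  refine ⟨(AddEquiv.ofBijective φ ⟨fun a b h => ?_, ?_⟩).symm⟩
  · have h' : (a.1, a.1 + m * a.2) = (b.1, b.1 + m * b.2) := congrArg Subtype.val h
    obtain ⟨h1, h2⟩ := Prod.mk.inj h'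
    rw [h1] at h2
    have hm' : (m : ℤ) ≠ 0 := by exact_mod_cast hm.ne'
    exact Prod.ext h1 (mul_left_cancel₀ hm' (add_left_cancel h2))
  · rintro ⟨⟨j, k⟩, h⟩
    obtain ⟨i, hi⟩ := mem_cyclicPullback_iff.1 h
    exact ⟨(j, i), Subtype.ext (Prod.ext rfl (by
      change j + m * i = k
      simp only at hi
      omega))⟩

end

theorem mainTheorem6 (m : ℕ) (hm : 0 < m) {B : Type*} [TopologicalSpace B]
    (D : Delooping (Multiplicative (ZMod m)) B) (f : PointedMap Circle 1 B D.pt)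
    (hf : IsDeloopingOfQuotient D f) :
    PathConnectedSpace (HomotopyPullback f.toMap f.toMap) ∧
    IsHomotopyGroupoid (HomotopyPullback f.toMap f.toMap) ∧
    (∃ Φ : FundamentalGroup (HomotopyPullback f.toMap f.toMap)
          (HomotopyPullback.diag f.toMap 1) ≃* Multiplicative (cyclicPullback m),
      ∀ γ,
        FundamentalGroup.map (HomotopyPullback.fst f.toMap f.toMap)
            (HomotopyPullback.diag f.toMap 1) γ =
          circleGenerator ^ (Multiplicative.toAdd (Φ γ)).1.1 ∧
        FundamentalGroup.map (HomotopyPullback.snd f.toMap f.toMap)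
            (HomotopyPullback.diag f.toMap 1) γ =
          circleGenerator ^ (Multiplicative.toAdd (Φ γ)).1.2) ∧
    Nonempty (cyclicPullback m ≃+ ℤ × ℤ) ∧
    ∃ T : C(Circle × Circle, HomotopyPullback f.toMap f.toMap),
      T (1, 1) = HomotopyPullback.diag f.toMap 1 ∧ IsWeakHomotopyEquiv T := by
  -- Transport along `f.ptPath` is absorbed into the identification with `ℤ/m`, so the rest can be
  -- based at `f.toMap 1`.
  let e : FundamentalGroup B (f.toMap 1) ≃* Multiplicative (ZMod m) :=
    (FundamentalGroup.fundamentalGroupMulEquivOfPath f.ptPath).trans D.loopEquiv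
  have he : ∀ k : ℤ, e (FundamentalGroup.map f.toMap 1 (circleGenerator ^ k)) =
      Multiplicative.ofAdd (k : ZMod m) := hf
  have h1 : ∀ j k : ℤ, FundamentalGroup.map f.toMap 1 (circleGenerator ^ j) =
      FundamentalGroup.map f.toMap 1 (circleGenerator ^ k) ↔ (j : ZMod m) = k := fun j k => by
    rw [← e.injective.eq_iff, he, he, Multiplicative.ofAdd.injective.eq_iff]
  have h2 : ∀ c : FundamentalGroup B (f.toMap 1), ∃ k : ℤ,
      FundamentalGroup.map f.toMap 1 (circleGenerator ^ k) = c := fun c => by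
    obtain ⟨k, hk⟩ := ZMod.intCast_surjective (e c).toAdd
    exact ⟨k, e.injective ((he k).trans (congrArg Multiplicative.ofAdd hk))⟩
  have hR : PathConnectedSpace (HomotopyPullback f.toMap f.toMap) :=
    ⟨⟨HomotopyPullback.diag f.toMap 1⟩, fun x y => (joined_diag h2 x).symm.trans (joined_diag h2 y)⟩
  refine ⟨hR, isHomotopyGroupoid_pullback D.groupoid f.toMap,
    exists_pullback_fundamentalGroupEquiv D.groupoid h1, nonempty_cyclicPullback_addEquiv hm, ?_⟩
  obtain ⟨T, hT1, hT⟩ := exists_torus_to_pullback D.groupoid (m := m) ((h1 0 m).2 (by simp))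
  refine ⟨T, hT1, isWeakHomotopyEquiv_torus D.groupoid (by exact_mod_cast hm.ne') ?_ hT⟩
  intro j k h
  exact (ZMod.intCast_eq_intCast_iff_dvd_sub _ _ _).1 ((h1 j k).1 h)
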